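/- Let $E$ be a countable (finite or countably infinite) set and let $(M_i : i\in\Theta)$ be a family of matroids on $E$, where $\Theta$ is an arbitrary index set. (Matroids may be infinite: $M=(E,\mathcal I)$ is a matroid if $\mathcal I\subseteq\mathcal P(E)$ contains $\varnothing$, is closed under taking subsets, for every non-maximal $I\in\mathcal I$ and every maximal $J\in\mathcal I$ there is an $e\in J\setminus I$ with $I\cup\{e\}\in\mathcal I$, and for every $X\subseteq E$ each $I\in\mathcal I\cap\mathcal P(X)$ extends to a maximal element of $\mathcal I\cap\mathcal P(X)$.) A matroid is finitary if every set all of whose finite subsets are independent is itself independent, and cofinitary if its dual $M^*$ (the matroid on $E$ whose bases are the complements of the bases of $M$) is finitary. Assume that each $M_i$ is the direct sum of a finitary matroid and a cofinitary matroid (i.e. $M_i\in\mathfrak F\oplus\mathfrak F^*$). Then there is a partition $E=E_p\sqcup E_c$ (parts may be empty) such that 1. $(M_i\restriction E_p : i\in\Theta)$ admits a packing: there are pairwise disjoint sets $S_i\subseteq E_p$ $(i\in\Theta)$ such that $S_i$ is spanning in the restriction $M_i\restriction E_p$ for every $i\in\Theta$; and 2. $(M_i.E_c : i\in\Theta)$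 admits a covering: there are sets $I_i\subseteq E_c$ $(i\in\Theta)$ with $\bigcup_{i\in\Theta}I_i=E_c$ such that $I_i$ is independent in $M_i.E_c$ for every $i\in\Theta$, where $M_i.E_c:=M_i/(E\setminus E_c)=(M_i^*\restriction E_c)^*$ is the contraction of $M_i$ onto $E_c$. -/

import Mathlib

namespace Matroid

/-- `M` is cofinitary if its dual is finitary, i.e. all its cocircuits are finite. -/
def IsCofinitary {α : Type*} (M : Matroid α) : Prop := M✶.Finitary

/-- The class `𝔉 ⊕ 𝔉*`: `M` is the direct sum of a finitary matroid and a cofinitary matroid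
(on disjoint, possibly empty, ground sets whose union is the ground set of `M`). -/
def IsFinitarySumCofinitary {α : Type*} (M : Matroid α) : Prop :=
  ∃ (F C : Matroid α) (h : Disjoint F.E C.E),
    F.Finitary ∧ C.IsCofinitary ∧ M = F.disjointSum C h

/-- The contraction of `M` onto `X`, i.e. the minor `M.X := M / (E(M) \ X)`. -/
def contractOnto {α : Type*} (M : Matroid α) (X : Set α) : Matroid α :=
  M.contract (M.E \ X)

/-- `S` is a packing for the family `M`: the sets `S i` are pairwise disjoint and `S i` is a
spanning subset of the ground set of `M i`. -/
def IsPacking {α Θ : Type*} (M : Θ → Matroid α) (S : Θ → Set α) : Prop :=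
  (∀ i j, i ≠ j → Disjoint (S i) (S j)) ∧ ∀ i, (M i).Spanning (S i)

/-- `I` is a covering for the family `M` of matroids on the common ground set `E`: the union of
the sets `I i` is `E`, and `I i` is independent in `M i`. -/
def IsCovering {α Θ : Type*} (E : Set α) (M : Θ → Matroid α) (I : Θ → Set α) : Prop :=
  (⋃ i, I i) = E ∧ ∀ i, (M i).Indep (I i)

end Matroid

/-!
For countably many matroids `M i`, intersect their direct sum on `Θ × E` with the matroid in which
a set is independent iff it contains at most one copy `(i, e)` of every `e`. If `B` is a common
independent set such that `B ∩ P` spans `P` in the first and `B \ P` spans the complement of `P` in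
the second matroid, then the slices of `B` pack the set of all `e` whose copies all lie in `P` and
cover the other elements.

Such `B` and `P` exist for two finitary matroids on a countable set (Aharoni and Ziv): contracting a
maximal wave leaves a loose pair, and there a set that is independent in the first and spanning in
the second matroid is built in countably many steps, each splitting off a feasible pair. Augmenting
paths make a given finite set spanned in the second matroid; if they got stuck, the hulls of the
elements that stay unreachable would grow to a nonempty wave.

A cofinitary summand `C` is removed by doubling the ground set. On the left `C` becomes free, but
only one of the two copies of an element may be used; on the right the second copy carries the
finitary matroid `C✶`. Complementation turns the part of `B` in the second copy back into a basis
for `C`.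

For arbitrary `Θ`, the elements that are nonloops of only countably many `M i` concern a countable
subfamily. The remaining elements can be covered by distinct members outside this subfamily, in
which all elements of the first kind are loops and hence packed by the empty set.
-/

namespace PackingCovering

open Set Matroid

section Generic

variable {α σ ι : Type*} {M : Matroid α} {I S S' W W' X : Set α}

lemma indep_iUnion_of_directed [Nonempty ι] [M.Finitary] {I : ι → Set α}
    (hdir : Directed (· ⊆ ·) I) (hI : ∀ i, M.Indep (I i)) : M.Indep (⋃ i, I i) := by
  refine indep_of_forall_finite_subset_indep _ fun J hJ hJfin ↦ ?_
  obtain ⟨i, hi⟩ := hdir.exists_mem_subset_of_finset_subset_biUnion (s := hJfin.toFinset)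
    (by simpa using hJ)
  exact (hI i).subset (by simpa using hi)

lemma exists_subset_of_finite_of_subset_iUnion [Nonempty ι] {A : ι → Set α} {F : Set α}
    (hdir : Directed (· ⊆ ·) A) (hF : F.Finite) (hFA : F ⊆ ⋃ i, A i) : ∃ i, F ⊆ A i := by
  obtain ⟨i, hi⟩ := hdir.exists_mem_subset_of_finset_subset_biUnion (s := hF.toFinset)
    (by simpa using hFA)
  exact ⟨i, by simpa using hi⟩

lemma exists_seq_of_countable {E : Set α} (hE : E.Countable) {r : σ → σ → Prop} [Std.Refl r]
    [IsTrans σ r] {P : α → σ → Prop} (h : ∀ e ∈ E, ∀ x, ∃ y, r x y ∧ P e y) (x₀ : σ) :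
    ∃ s : ℕ → σ, s 0 = x₀ ∧ (∀ m n, m ≤ n → r (s m) (s n)) ∧ ∀ e ∈ E, ∃ n, P e (s n) := by
  obtain rfl | hne := E.eq_empty_or_nonempty
  · exact ⟨fun _ ↦ x₀, rfl, fun _ _ _ ↦ refl _, by simp⟩
  obtain ⟨f, hf⟩ := hE.exists_eq_range hne
  choose! g hrg hPg using h
  refine ⟨fun n ↦ n.rec x₀ fun k x ↦ g (f k) x, rfl, fun m n hmn ↦ ?_, fun e he ↦ ?_⟩
  · exact Nat.rel_of_forall_rel_succ_of_le r (fun k ↦ hrg _ (hf ▸ mem_range_self k) _) hmn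
  · obtain ⟨k, rfl⟩ := hf ▸ he
    exact ⟨k + 1, hPg _ he _⟩

lemma exists_injective_forall_mem [Countable ι] {A : ι → Set α} (hA : ∀ k, (A k).Infinite) :
    ∃ f : ι → α, f.Injective ∧ ∀ k, f k ∈ A k := by
  classical
  have := Encodable.ofCountable ι
  choose T hTA hTcard using fun k ↦ (hA k).exists_subset_card_eq (Encodable.encode k + 1)
  suffices hall : ∀ K : Finset ι, K.card ≤ (K.biUnion T).card by
    obtain ⟨f, hf, hfT⟩ := (Finset.all_card_le_biUnion_card_iff_exists_injective T).1 hall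
    exact ⟨f, hf, fun k ↦ hTA k (hfT k)⟩
  intro K
  obtain rfl | hK := K.eq_empty_or_nonempty
  · simp
  obtain ⟨k, hk, hmax⟩ := K.exists_max_image Encodable.encode hK
  calc K.card = (K.image Encodable.encode).card :=
        (Finset.card_image_of_injective _ Encodable.encode_injective).symm
    _ ≤ (Finset.range (Encodable.encode k + 1)).card :=
        Finset.card_le_card fun n ↦ by
          simp only [Finset.mem_image, Finset.mem_range]
          rintro ⟨j, hj, rfl⟩
          exact Nat.lt_succ_of_le (hmax j hj)
    _ = (T k).card := by rw [Finset.card_range, hTcard]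
    _ ≤ (K.biUnion T).card := Finset.card_le_card (Finset.subset_biUnion_of_mem T hk)

lemma contract_indep_iff_forall_notMem_closure :
    (M ／ X).Indep I ↔ I ⊆ M.E \ X ∧ ∀ e ∈ I, e ∉ M.closure (I \ {e} ∪ X) := by
  by_cases hI : I ⊆ M.E \ X
  · rw [indep_iff_forall_notMem_closure_sdiff hI]
    simp only [hI, true_and, contract_closure_eq, mem_sdiff, not_and, not_not]
    exact forall₂_congr fun e he ↦ ⟨fun h hcl ↦ (hI he).2 (h hcl), fun h hcl ↦ (h hcl).elim⟩
  · exact iff_of_false (fun h ↦ hI h.subset_ground) fun h ↦ hI h.1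

lemma isBasis_union_of_contract (h : M.IsBasis S W) (h' : (M ／ W).IsBasis S' W') :
    M.IsBasis (S ∪ S') (W ∪ W') := by
  have hS' := (h.contract_indep_iff.1 h'.indep).1
  have hW' : W' ⊆ M.E := h'.subset_ground.trans sdiff_subset
  have hcl : W' ⊆ M.closure (S' ∪ W) := h'.subset_closure.trans <| by
    rw [contract_closure_eq]; exact sdiff_subset
  rw [union_comm S' S] at hS'
  refine hS'.isBasis_of_subset_of_subset_closure (union_subset_union h.subset h'.subset)
    (union_subset (h.subset_closure.trans (M.closure_subset_closure subset_union_left)) ?_)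
  rwa [closure_union_congr_right h.closure_eq_closure.symm, union_comm] at hcl

lemma spanning_insert_of_notMem_closure {x r : α} (hx : M.Spanning (insert x X)) (hr : r ∈ M.E)
    (hrX : r ∉ M.closure X) : M.Spanning (insert r X) := by
  rw [spanning_iff_closure_eq (insert_subset hr ((subset_insert _ _).trans hx.subset_ground)),
    ← hx.closure_eq]
  exact closure_insert_congr ⟨hx.closure_eq ▸ hr, hrX⟩

end Generic

section Swap

variable {β : Type*} {M N : Matroid β} {J J' J₀ : Set β} {r v x : β}

/-- An exchange of one element of `J` for an element that is spanned by `J` in `N` but not in `M`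
and such that the span in `N` does not change: the alternating step of matroid intersection. -/
def SwapStep (M N : Matroid β) (J J' : Set β) : Prop :=
  ∃ w h, w ∈ M.E ∧ w ∉ M.closure J ∧ w ∈ N.closure J ∧ h ∈ J ∧ J' = insert w (J \ {h}) ∧
    N.closure J' = N.closure J

/-- `J'` arises from `J` by an alternating path, i.e. by finitely many swap steps. -/
def Swaps (M N : Matroid β) : Set β → Set β → Prop := Relation.ReflTransGen (SwapStep M N)

/-- The elements at which an alternating path starting from `J₀` could end, namely those which
some set obtained from `J₀` by swaps leaves unspanned in `M`. -/
def swapReach (M N : Matroid β) (J₀ : Set β) : Set β :=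
  {r | r ∈ M.E ∧ ∃ J, Swaps M N J₀ J ∧ r ∉ M.closure J}

lemma SwapStep.indep (h : SwapStep M N J J') (hJ : M.Indep J) : M.Indep J' := by
  obtain ⟨w, h, hwE, hw, -, -, rfl, -⟩ := h
  exact (hJ.insert_indep_iff.2 (.inl ⟨hwE, hw⟩)).subset (insert_subset_insert sdiff_subset)

lemma Swaps.indep (h : Swaps M N J J') (hJ : M.Indep J) : M.Indep J' := by
  induction h with
  | refl => exact hJ
  | tail _ h ih => exact h.indep ih

lemma SwapStep.indep_right (h : SwapStep M N J J') (hJ : N.Indep J) : N.Indep J' := by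
  obtain ⟨w, h, -, -, hwN, hh, rfl, hcl⟩ := h
  refine (hJ.subset sdiff_subset).insert_indep_iff.2
    (.inl ⟨N.closure_subset_ground _ hwN, fun hcon ↦ hJ.notMem_closure_sdiff_of_mem hh ?_⟩)
  rw [← closure_insert_eq_of_mem_closure hcon, hcl]
  exact N.mem_closure_of_mem hh hJ.subset_ground

lemma Swaps.indep_right (h : Swaps M N J J') (hJ : N.Indep J) : N.Indep J' := by
  induction h with
  | refl => exact hJ
  | tail _ h ih => exact h.indep_right ih

lemma Swaps.closure_eq (h : Swaps M N J J') : N.closure J' = N.closure J := by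
  induction h with
  | refl => rfl
  | tail _ h ih =>
    obtain ⟨_, _, -, -, -, -, -, hcl⟩ := h
    exact hcl.trans ih

lemma SwapStep.spanning_insert (h : SwapStep M N J J') (hx : M.Spanning (insert x J))
    (hr : r ∈ M.E) (hrJ : r ∉ M.closure J') : M.Spanning (insert r J') := by
  obtain ⟨w, h, hwE, hw, -, hh, rfl, -⟩ := h
  refine spanning_insert_of_notMem_closure (x := h) ?_ hr hrJ
  rw [insert_comm, insert_sdiff_singleton, insert_eq_of_mem hh]
  exact spanning_insert_of_notMem_closure hx hwE hw

lemma Swaps.spanning_insert (h : Swaps M N J J') (hx : M.Spanning (insert x J))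
    (hr : r ∈ M.E) (hrJ : r ∉ M.closure J') : M.Spanning (insert r J') := by
  induction h generalizing r with
  | refl => exact spanning_insert_of_notMem_closure hx hr hrJ
  | tail _ hstep ih =>
    obtain ⟨w, _, hwE, hw, -⟩ := id hstep
    exact hstep.spanning_insert (ih hwE hw) hr hrJ

lemma Swaps.finite_sdiff (h : Swaps M N J J') : (J' \ J).Finite ∧ (J \ J').Finite := by
  induction h with
  | refl => simp
  | tail _ h ih =>
    obtain ⟨w, h, -, -, -, -, rfl, -⟩ := h
    exact ⟨(ih.1.insert w).subset (by grind), (ih.2.insert h).subset (by grind)⟩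

lemma Swaps.mem_swapReach (hJ₀ : M.Indep J₀) (hs : Swaps M N J₀ J) {h : β} (hh : h ∈ J)
    (hrE : r ∈ M.E) (hr : r ∉ M.closure J) (hstep : SwapStep M N J (insert r (J \ {h}))) :
    h ∈ swapReach M N J₀ := by
  have hJ := hs.indep hJ₀
  have hhr : h ≠ r := by
    rintro rfl
    exact hr (M.mem_closure_of_mem hh hJ.subset_ground)
  have hins : M.Indep (insert r J) := hJ.insert_indep_iff.2 (.inl ⟨hrE, hr⟩)
  refine ⟨hJ.subset_ground hh, _, hs.tail hstep, fun hcl ↦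
    hins.notMem_closure_sdiff_of_mem (.inr hh) ?_⟩
  rwa [← insert_sdiff_singleton_comm hhr.symm]

lemma Swaps.mem_closure_inter_swapReach (hJ₀ : M.Indep J₀)
    (hs : Swaps M N J₀ J) (hrE : r ∈ M.E) (hr : r ∉ M.closure J) (hrJ : r ∈ N.closure J) :
    r ∈ N.closure (J ∩ swapReach M N J₀) := by
  have hrJ' : r ∉ J := fun h ↦ hr (M.mem_closure_of_mem h (hs.indep hJ₀).subset_ground)
  obtain ⟨C, hCJ, hC, hrC⟩ := (mem_closure_iff_exists_isCircuit hrJ').1 hrJ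
  refine N.closure_subset_closure ?_ (hC.mem_closure_sdiff_singleton_of_mem hrC)
  rintro h ⟨hhC, hhr⟩
  have hhJ : h ∈ J := (hCJ hhC).resolve_left hhr
  refine ⟨hhJ, hs.mem_swapReach hJ₀ hhJ hrE hr ⟨r, h, hrE, hr, hrJ, hhJ, rfl, ?_⟩⟩
  have hh : h ∈ N.closure (insert r J \ {h}) :=
    N.closure_subset_closure (sdiff_subset_sdiff_left hCJ)
      (hC.mem_closure_sdiff_singleton_of_mem hhC)
  rw [insert_sdiff_singleton_comm (Ne.symm hhr), closure_sdiff_singleton_eq_closure hh,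
    closure_insert_eq_of_mem_closure hrJ]

lemma Swaps.inter_swapReach_subset_closure (hE : M.E = N.E) (hJ₀ : M.Indep J₀)
    (hs : Swaps M N J₀ J) :
    J ∩ swapReach M N J₀ ⊆ N.closure (J₀ ∩ swapReach M N J₀) := by
  induction hs with
  | refl => exact N.subset_closure _ (inter_subset_left.trans (hE ▸ hJ₀.subset_ground))
  | tail hs h ih =>
    obtain ⟨w, h, hwE, hw, hwN, -, rfl, -⟩ := h
    rintro a ⟨rfl | ha, haR⟩
    · exact closure_subset_closure_of_subset_closure ih
        (Swaps.mem_closure_inter_swapReach hJ₀ hs hwE hw hwN)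
    · exact ih ⟨ha.1, haR⟩

lemma swapReach_inter_closure_subset (hE : M.E = N.E) (hJ₀ : M.Indep J₀) :
    swapReach M N J₀ ∩ N.closure J₀ ⊆ N.closure (J₀ ∩ swapReach M N J₀) := by
  rintro r ⟨⟨hrE, J, hs, hr⟩, hrN⟩
  exact closure_subset_closure_of_subset_closure (hs.inter_swapReach_subset_closure hE hJ₀)
    (hs.mem_closure_inter_swapReach hJ₀ hrE hr (hs.closure_eq.symm ▸ hrN))

lemma Swaps.sdiff_swapReach (hJ₀ : M.Indep J₀) (hs : Swaps M N J₀ J) :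
    J \ swapReach M N J₀ = J₀ \ swapReach M N J₀ := by
  induction hs with
  | refl => rfl
  | tail hs hstep ih =>
    obtain ⟨w, h, hwE, hw, -, hh, rfl, -⟩ := id hstep
    have hwR : w ∈ swapReach M N J₀ := ⟨hwE, _, hs, hw⟩
    have hhR : h ∈ swapReach M N J₀ := Swaps.mem_swapReach hJ₀ hs hh hwE hw hstep
    grind

lemma Swaps.mem_closure_inter (hJ₀ : M.Indep J₀) (hv : ∀ J, Swaps M N J₀ J → v ∈ M.closure J)
    (hs : Swaps M N J₀ J) : v ∈ M.closure (J₀ ∩ J) := by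
  induction hs with
  | refl => simpa using hv _ .refl
  | @tail K K' hs hstep ih =>
    have hK' := hv _ (hs.tail hstep)
    obtain ⟨w, h, hwE, hw, -, -, rfl, -⟩ := hstep
    have hK : M.Indep (insert w K) := (Swaps.indep hs hJ₀).insert_indep_iff.2 (.inl ⟨hwE, hw⟩)
    have hmem : v ∈ M.closure (J₀ ∩ K ∩ insert w (K \ {h})) := by
      rw [Indep.closure_inter_eq_inter_closure (hK.subset (by grind))]
      exact ⟨ih, hK'⟩
    exact M.closure_subset_closure (by grind) hmem

lemma sdiff_swapReach_subset_closure (hJ₀ : M.Indep J₀) :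
    M.E \ swapReach M N J₀ ⊆ M.closure (J₀ \ swapReach M N J₀) := by
  rintro v ⟨hvE, hv⟩
  have hv : ∀ J, Swaps M N J₀ J → v ∈ M.closure J := fun J hs ↦ by
    by_contra hcon
    exact hv ⟨hvE, J, hs, hcon⟩
  have : Nonempty {J // Swaps M N J₀ J} := ⟨⟨J₀, .refl⟩⟩
  have hmem : v ∈ M.closure (⋂ J : {J // Swaps M N J₀ J}, J₀ ∩ J.1) := by
    rw [hJ₀.closure_iInter_eq_biInter_closure_of_forall_subset fun _ ↦ inter_subset_left]
    exact mem_iInter.2 fun J ↦ Swaps.mem_closure_inter hJ₀ hv J.2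
  refine M.closure_subset_closure (fun a ha ↦ ?_) hmem
  have ha : ∀ J, Swaps M N J₀ J → a ∈ J₀ ∩ J := fun J hJ ↦ mem_iInter.1 ha ⟨J, hJ⟩
  refine ⟨(ha _ .refl).1, fun ⟨_, J, hs, haJ⟩ ↦ haJ ?_⟩
  exact M.mem_closure_of_mem (ha J hs).2 (hs.indep hJ₀).subset_ground

end Swap

section Wave

variable {β : Type*} {M N : Matroid β} {W S W' S' Q I Q' I' B : Set β} {u : β}

/-- A wave of the pair `(M, N)`: a set `W` with an `M`-basis `S` of `W` that is still independent
when `N` is contracted onto `W`. -/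
structure IsWave (M N : Matroid β) (W S : Set β) : Prop where
  isBasis : M.IsBasis S W
  indep : (N.contractOnto W).Indep S

/-- The pair `(M, N)` is loose if it has no nonempty wave. -/
def Loose (M N : Matroid β) : Prop := ∀ W S, IsWave M N W S → W = ∅

lemma contractOnto_contractOnto (N : Matroid β) (h : W ⊆ Q) :
    (N.contractOnto Q).contractOnto W = N.contractOnto W := by
  simp only [contractOnto, contract_ground, contract_contract]
  congr 1
  grind

lemma contract_delete_ground_of_subset (hIQ : I ⊆ Q) : (N ／ I ＼ Q).E = N.E \ Q := by
  rw [delete_ground, contract_ground, sdiff_sdiff, union_eq_self_of_subset_left hIQ]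

lemma contractOnto_contract_delete_indep_iff (hIQ : I ⊆ Q) :
    ((N ／ I ＼ Q).contractOnto W).Indep S ↔
      (N ／ (I ∪ (N.E \ (Q ∪ W)))).Indep S ∧ Disjoint S Q := by
  have hground : (N ／ I ＼ Q).E \ W = N.E \ (Q ∪ W) := by
    rw [contract_delete_ground_of_subset hIQ, sdiff_sdiff]
  rw [contractOnto, hground, contract_delete_contract _ _ _ _ (by grind), delete_indep_iff]

lemma IsWave.union (h : IsWave M N W S) (h' : IsWave (M ／ W) (N ／ S ＼ W) W' S') :
    IsWave M N (W ∪ W') (S ∪ S') := by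
  refine ⟨isBasis_union_of_contract h.isBasis h'.isBasis, ?_⟩
  have hS' := ((contractOnto_contract_delete_indep_iff h.isBasis.subset).1 h'.indep).1
  have hS : (N ／ (N.E \ (W ∪ W'))).Indep S := by
    have hsplit : N.E \ W = N.E \ (W ∪ W') ∪ (N.E ∩ W') \ W := by grind
    have hSW := h.indep
    rw [contractOnto, hsplit, ← contract_contract] at hSW
    exact hSW.of_contract
  rw [union_comm, ← contract_contract, hS.contract_indep_iff] at hS'
  exact union_comm S' S ▸ hS'.2

lemma IsWave.iUnion_of_directed {ι : Type*} [Nonempty ι] [M.Finitary] {W S : ι → Set β}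
    (h : ∀ i, IsWave M N (W i) (S i)) (hdir : Directed (· ⊆ ·) S)
    (hSW : ∀ i j, S j ∩ W i ⊆ S i) : IsWave M N (⋃ i, W i) (⋃ i, S i) where
  isBasis := by
    have hS := indep_iUnion_of_directed hdir fun i ↦ (h i).isBasis.indep
    exact hS.isBasis_of_subset_of_subset_closure (iUnion_mono fun i ↦ (h i).isBasis.subset)
      (iUnion_subset fun i ↦ (h i).isBasis.subset_closure.trans
        (M.closure_subset_closure (subset_iUnion S i)))
  indep := by
    have hi i := contract_indep_iff_forall_notMem_closure.1 (h i).indep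
    refine contract_indep_iff_forall_notMem_closure.2 ⟨?_, fun s hs hcl ↦ ?_⟩
    · exact iUnion_subset fun i ↦ (hi i).1.trans fun e he ↦ ⟨he.1, fun hmem ↦
        hmem.2 (mem_iUnion_of_mem i (by_contra fun hW ↦ he.2 ⟨he.1, hW⟩))⟩
    · obtain ⟨i, hsi⟩ := mem_iUnion.1 hs
      refine (hi i).2 s hsi (N.closure_subset_closure ?_ hcl)
      rintro a (⟨ha, has⟩ | ha)
      · obtain ⟨j, haj⟩ := mem_iUnion.1 ha
        by_cases haW : a ∈ W i
        · exact .inl ⟨hSW i j ⟨haj, haW⟩, has⟩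
        · exact .inr ⟨((hi j).1 haj).1, haW⟩
      · exact .inr ⟨ha.1, fun haW ↦ ha.2 (mem_iUnion_of_mem i haW)⟩

/-- The order on pairs `(W, S)` for which the union of a chain of waves is a wave: the larger
second component gains no elements inside the smaller first component. -/
def WaveLE (p q : Set β × Set β) : Prop := p.1 ⊆ q.1 ∧ p.2 ⊆ q.2 ∧ q.2 ∩ p.1 ⊆ p.2

lemma exists_isWave_upperBound_of_isChain [M.Finitary] {c : Set (Set β × Set β)}
    (hne : c.Nonempty) (hwave : ∀ p ∈ c, IsWave M N p.1 p.2) (hc : IsChain WaveLE c) :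
    ∃ q, IsWave M N q.1 q.2 ∧ ∀ p ∈ c, WaveLE p q := by
  have := hne.to_subtype
  have htotal (p q : c) : WaveLE p.1 q ∨ WaveLE q.1 p := by
    obtain h | h := eq_or_ne p.1 q.1
    · exact .inl (h ▸ ⟨Subset.rfl, Subset.rfl, inter_subset_left⟩)
    · exact hc p.2 q.2 h
  have hinter (p q : c) : q.1.2 ∩ p.1.1 ⊆ p.1.2 :=
    (htotal p q).elim (fun h ↦ h.2.2) fun h ↦ inter_subset_left.trans h.2.1
  refine ⟨(⋃ p : c, p.1.1, ⋃ p : c, p.1.2),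
    .iUnion_of_directed (fun p ↦ hwave p p.2) (fun p q ↦ ?_) hinter,
    fun p hp ↦ ⟨subset_iUnion (fun p : c ↦ p.1.1) ⟨p, hp⟩,
      subset_iUnion (fun p : c ↦ p.1.2) ⟨p, hp⟩, ?_⟩⟩
  · exact (htotal p q).elim (fun h ↦ ⟨q, h.2.1, Subset.rfl⟩) fun h ↦ ⟨p, Subset.rfl, h.2.1⟩
  · rw [iUnion_inter]
    exact iUnion_subset fun q ↦ hinter ⟨p, hp⟩ q

lemma exists_isWave_loose (M N : Matroid β) [M.Finitary] :
    ∃ W S, IsWave M N W S ∧ Loose (M ／ W) (N ／ S ＼ W) := by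
  have hbdd (c : Set {p : Set β × Set β // IsWave M N p.1 p.2})
      (hc : IsChain (fun p q ↦ WaveLE p.1 q.1) c) : ∃ q : {p : Set β × Set β // IsWave M N p.1 p.2},
      ∀ p ∈ c, WaveLE p.1 q.1 := by
    obtain rfl | hne := c.eq_empty_or_nonempty
    · exact ⟨⟨(∅, ∅), M.empty_indep.isBasis_self, Matroid.empty_indep _⟩, by simp⟩
    have hchain : IsChain WaveLE (Subtype.val '' c) := by
      rintro _ ⟨p, hp, rfl⟩ _ ⟨q, hq, rfl⟩ hpq
      exact hc hp hq (ne_of_apply_ne _ hpq)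
    obtain ⟨q, hq, hle⟩ := exists_isWave_upperBound_of_isChain (hne.image Subtype.val)
      (by rintro _ ⟨p, -, rfl⟩; exact p.2) hchain
    exact ⟨⟨q, hq⟩, fun p hp ↦ hle _ (mem_image_of_mem _ hp)⟩
  obtain ⟨⟨⟨W, S⟩, hWS⟩, hmax⟩ := exists_maximal_of_chains_bounded hbdd
    fun hpq hqs ↦ ⟨hpq.1.trans hqs.1, hpq.2.1.trans hqs.2.1, by grind [WaveLE]⟩
  refine ⟨W, S, hWS, fun W' S' h' ↦ ?_⟩
  have hW' := subset_sdiff.1 h'.isBasis.subset_ground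
  have hS' : Disjoint S' W := hW'.2.mono_left h'.isBasis.subset
  have hle := hmax ⟨(W ∪ W', S ∪ S'), hWS.union h'⟩
    ⟨subset_union_left, subset_union_left, by grind⟩
  exact hW'.2.eq_bot_of_le (subset_union_right.trans hle.1)

lemma IsWave.of_restrict_contractOnto (hQ : Q ⊆ M.E)
    (h : IsWave (M ↾ Q) (N.contractOnto Q) W S) : IsWave M N W S := by
  obtain ⟨hb, hWQ⟩ := (isBasis_restrict_iff hQ).1 h.isBasis
  exact ⟨hb, contractOnto_contractOnto N hWQ ▸ h.indep⟩

lemma Loose.ground_eq_empty (hL : Loose M N) (hE : M.E = N.E) (hB : M.IsBase B)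
    (hBN : N.Indep B) : M.E = ∅ :=
  hL M.E B ⟨hB.isBasis_ground, by simpa [contractOnto, hE] using hBN⟩

lemma IsWave.sdiff_swapReach (hE : M.E = N.E) (hM : M.Indep S) (hN : N.Indep S)
    (hR : swapReach M N S ⊆ N.closure S) :
    IsWave M N (M.E \ swapReach M N S) (S \ swapReach M N S) where
  isBasis := (hM.subset sdiff_subset).isBasis_of_subset_of_subset_closure
    (sdiff_subset_sdiff_left hM.subset_ground) (sdiff_swapReach_subset_closure hM)
  indep := by
    have hRE : swapReach M N S ⊆ N.E := hR.trans (N.closure_subset_ground S)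
    have hcl := swapReach_inter_closure_subset hE hM
    rw [inter_eq_left.2 hR] at hcl
    have hbasis : N.IsBasis (S ∩ swapReach M N S) (swapReach M N S) :=
      (hN.subset inter_subset_left).isBasis_of_subset_of_subset_closure inter_subset_right hcl
    rw [contractOnto, hE, sdiff_sdiff_cancel_left hRE, hbasis.contract_indep_iff,
      sdiff_union_inter]
    exact ⟨hN, disjoint_sdiff_right⟩

lemma Loose.spanning_of_isBase_insert (hL : Loose M N) (hE : M.E = N.E)
    (hB : M.IsBase (insert u S)) (hS : N.Indep S) : N.Spanning (insert u S) := by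
  have hins : insert u S ⊆ N.E := hE ▸ hB.subset_ground
  have hSM : M.Indep S := hB.indep.subset (subset_insert _ _)
  suffices hsp : N.E ⊆ N.closure (insert u S) from spanning_iff_ground_subset_closure hins |>.2 hsp
  by_cases hR : swapReach M N S ⊆ N.closure S
  · have hRE := hL _ _ (IsWave.sdiff_swapReach hE hSM hS hR)
    exact (hE ▸ sdiff_eq_empty.1 hRE).trans
      (hR.trans (N.closure_subset_closure (subset_insert _ _)))
  obtain ⟨r, ⟨hrE, J, hJ, hrJ⟩, hrN⟩ := not_subset.1 hR
  have hbase : M.IsBase (insert r J) :=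
    ((hJ.indep hSM).insert_indep_iff.2 (.inl ⟨hrE, hrJ⟩)).isBase_of_spanning
      (hJ.spanning_insert hB.spanning hrE hrJ)
  have hindep : N.Indep (insert r J) :=
    (hJ.indep_right hS).insert_indep_iff.2 (.inl ⟨hE ▸ hrE, by rwa [hJ.closure_eq]⟩)
  simp [← hE, hL.ground_eq_empty hE hbase hindep]

/-- A pair `(Q, I)` that can be split off from a matroid intersection problem `(M, N)`: `I` spans
`Q` in `M`, and in `N` it spans `Q` together with the elements outside `Q`, while the remaining
problem, in which `Q` is contracted in `M` but only `I` in `N`, is loose. -/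
structure IsFeasible (M N : Matroid β) (Q I : Set β) : Prop where
  isBasis : M.IsBasis I Q
  spanning : N.Spanning (I ∪ (N.E \ Q))
  loose : Loose (M ／ Q) (N ／ I ＼ Q)

lemma Loose.isFeasible_empty (hL : Loose M N) : IsFeasible M N ∅ ∅ :=
  ⟨M.empty_indep.isBasis_self, by simpa using N.ground_spanning, by simpa using hL⟩

lemma IsFeasible.union (hE : M.E = N.E) (h : IsFeasible M N Q I)
    (h' : IsFeasible (M ／ Q) (N ／ I ＼ Q) Q' I') : IsFeasible M N (Q ∪ Q') (I ∪ I') := by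
  have hI : I ⊆ N.E := hE ▸ h.isBasis.indep.subset_ground
  have hI'Q : Disjoint I' Q := (subset_sdiff.1 h'.isBasis.indep.subset_ground).2
  refine ⟨isBasis_union_of_contract h.isBasis h'.isBasis, ?_, ?_⟩
  · have hsub : I ∪ I' ∪ (N.E \ (Q ∪ Q')) ⊆ N.E :=
      union_subset (union_subset hI (hE ▸ h'.isBasis.indep.subset_ground.trans sdiff_subset))
        sdiff_subset
    have hrest : N.E \ Q ⊆ N.closure (I ∪ I' ∪ (N.E \ (Q ∪ Q'))) := by
      have hcl := spanning_iff_ground_subset_closure (h'.spanning.subset_ground) |>.1 h'.spanning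
      rw [contract_delete_ground_of_subset h.isBasis.subset, delete_closure_eq,
        contract_closure_eq] at hcl
      exact fun e he ↦ N.closure_subset_closure (by grind) (hcl he).1.1
    refine (spanning_iff_ground_subset_closure hsub).2 (h.spanning.closure_eq.superset.trans ?_)
    exact closure_subset_closure_of_subset_closure (union_subset
      (N.subset_closure_of_subset' (subset_union_left.trans subset_union_left) hI) hrest)
  · have hloose := h'.loose
    rwa [contract_contract, contract_delete_contract_delete _ _ _ _ _ hI'Q] at hloose

lemma Loose.exists_isFeasible_mem [M.Finitary] (hL : Loose M N) (hE : M.E = N.E) (hu : u ∈ M.E) :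
    ∃ Q I, IsFeasible M N Q I ∧ u ∈ Q := by
  have hu' : M.Indep {u} := by
    by_contra hcon
    have hloop : M.IsLoop u := (singleton_not_indep hu).1 hcon
    have hwave : IsWave M N {u} ∅ :=
      ⟨M.empty_indep.isBasis_of_subset_of_subset_closure (empty_subset _)
        (singleton_subset_iff.2 hloop), Matroid.empty_indep _⟩
    exact singleton_ne_empty u (hL _ _ hwave)
  obtain ⟨W, S, hW, hWL⟩ := exists_isWave_loose (M ／ {u}) (N ／ {u} ＼ {u})
  have hI : M.IsBasis ({u} ∪ S) ({u} ∪ W) := isBasis_union_of_contract hu'.isBasis_self hW.isBasis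
  have hQE : {u} ∪ W ⊆ N.E := hE ▸ hI.subset_ground
  have hSu : Disjoint S {u} := (subset_sdiff.1 hW.isBasis.indep.subset_ground).2
  refine ⟨{u} ∪ W, {u} ∪ S, ⟨hI, ?_, ?_⟩, .inl rfl⟩
  · have hloose : Loose (M ↾ ({u} ∪ W)) (N.contractOnto ({u} ∪ W)) := fun _ _ h ↦
      hL _ _ (h.of_restrict_contractOnto hI.subset_ground)
    have hS : (N.contractOnto ({u} ∪ W)).Indep S := by
      have hS := ((contractOnto_contract_delete_indep_iff Subset.rfl).1 hW.indep).1
      rw [union_comm, ← contract_contract] at hS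
      exact hS.of_contract
    have hspan := hloose.spanning_of_isBase_insert (u := u)
      (by rw [restrict_ground_eq, contractOnto, contract_ground, sdiff_sdiff_cancel_left hQE])
      (by simpa only [singleton_union] using hI.isBase_restrict) hS
    exact ((contract_spanning_iff sdiff_subset).1 hspan).1
  · rwa [contract_contract, contract_delete_contract_delete _ _ _ _ _ hSu] at hWL

end Wave

section Augmentation

variable {β : Type*} {M N : Matroid β} {I I' V W T : Set β} {x : β}

/-- `I'` arises from `I` by an augmenting path: an element of `I` that is redundant in `N` is
removed, then some swaps follow, and finally an element not spanned by `I` in `N` is inserted. -/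
def AugStep (M N : Matroid β) (I I' : Set β) : Prop :=
  ∃ x ∈ I, x ∈ N.closure (I \ {x}) ∧ ∃ J r, Swaps M N (I \ {x}) J ∧ r ∈ M.E ∧ r ∉ M.closure J ∧
    r ∉ N.closure I ∧ I' = insert r J

/-- `I'` arises from `I` by finitely many augmenting paths. -/
def Augs (M N : Matroid β) : Set β → Set β → Prop := Relation.ReflTransGen (AugStep M N)

lemma AugStep.isBase (h : AugStep M N I I') (hI : M.IsBase I) : M.IsBase I' := by
  obtain ⟨x, hxI, -, J, r, hs, hrE, hrJ, -, rfl⟩ := h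
  have hJ := hs.indep (hI.indep.subset sdiff_subset)
  refine (hJ.insert_indep_iff.2 (.inl ⟨hrE, hrJ⟩)).isBase_of_spanning ?_
  refine hs.spanning_insert (x := x) ?_ hrE hrJ
  rw [insert_sdiff_singleton, insert_eq_of_mem hxI]
  exact hI.spanning

lemma Augs.isBase (h : Augs M N I I') (hI : M.IsBase I) : M.IsBase I' := by
  induction h with
  | refl => exact hI
  | tail _ h ih => exact h.isBase ih

lemma AugStep.closure_subset (h : AugStep M N I I') : N.closure I ⊆ N.closure I' := by
  obtain ⟨x, -, hx, J, r, hs, -, -, -, rfl⟩ := h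
  rw [← closure_sdiff_singleton_eq_closure hx, ← hs.closure_eq]
  exact N.closure_subset_closure (subset_insert _ _)

lemma Augs.closure_subset (h : Augs M N I I') : N.closure I ⊆ N.closure I' := by
  induction h with
  | refl => rfl
  | tail _ h ih => exact ih.trans h.closure_subset

lemma AugStep.finite_sdiff (h : AugStep M N I I') : (I' \ I).Finite ∧ (I \ I').Finite := by
  obtain ⟨x, -, -, J, r, hs, -, -, -, rfl⟩ := h
  obtain ⟨hJI, hIJ⟩ := hs.finite_sdiff
  exact ⟨((hJI.insert x).insert r).subset (by grind), (hIJ.insert x).subset (by grind)⟩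

lemma Augs.finite_sdiff (h : Augs M N I I') : (I' \ I).Finite ∧ (I \ I').Finite := by
  induction h with
  | refl => simp
  | tail _ h ih =>
    obtain ⟨hIK, hKI⟩ := h.finite_sdiff
    exact ⟨(ih.1.union hIK).subset (by grind), (ih.2.union hKI).subset (by grind)⟩

/-- The set `V` is spanned in `M` by `I ∩ V`, and the elements outside `V` that are spanned by `I`
in `N` are already spanned by `I \ V`. -/
structure IsTight (M N : Matroid β) (I V : Set β) : Prop where
  subset_closure : V ⊆ M.closure (I ∩ V)
  closure_sdiff_subset : N.closure I \ V ⊆ N.closure (I \ V)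

lemma isTight_ground (hE : M.E = N.E) (hI : M.IsBase I) : IsTight M N I M.E where
  subset_closure := by rw [inter_eq_self_of_subset_left hI.subset_ground, hI.closure_eq]
  closure_sdiff_subset := by
    rw [hE, sdiff_eq_empty.2 (N.closure_subset_ground I)]
    exact empty_subset _

lemma isTight_ground_sdiff_swapReach (hE : M.E = N.E) (hI : M.Indep I)
    (hx : x ∈ N.closure (I \ {x})) : IsTight M N I (M.E \ swapReach M N (I \ {x})) where
  subset_closure := (sdiff_swapReach_subset_closure (hI.subset sdiff_subset)).trans
    (M.closure_subset_closure fun _ ha ↦ ⟨ha.1.1, hI.subset_ground ha.1.1, ha.2⟩)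
  closure_sdiff_subset := by
    rintro a ⟨ha, haV⟩
    have haR : a ∈ swapReach M N (I \ {x}) := by
      by_contra hcon
      exact haV ⟨hE ▸ N.closure_subset_ground _ ha, hcon⟩
    rw [← closure_sdiff_singleton_eq_closure hx] at ha
    exact N.closure_subset_closure (by grind)
      (swapReach_inter_closure_subset hE (hI.subset sdiff_subset) ⟨haR, ha⟩)

/-- The elements that remain unspanned in `N` under all augmentations of `I`. -/
def unreachable (M N : Matroid β) (I : Set β) : Set β :=
  {e | e ∈ M.E ∧ ∀ J, Augs M N I J → e ∉ N.closure J}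

/-- The smallest tight set containing all unreachable elements. -/
def unreachableHull (M N : Matroid β) (I : Set β) : Set β :=
  ⋂₀ {V | IsTight M N I V ∧ unreachable M N I ⊆ V}

lemma Augs.unreachable_subset (h : Augs M N I I') : unreachable M N I ⊆ unreachable M N I' :=
  fun _ he ↦ ⟨he.1, fun K hK ↦ he.2 K (h.trans hK)⟩

lemma unreachable_subset_unreachableHull : unreachable M N I ⊆ unreachableHull M N I :=
  subset_sInter fun _ hV ↦ hV.2

lemma IsTight.unreachableHull_subset (h : IsTight M N I V) (hV : unreachable M N I ⊆ V) :
    unreachableHull M N I ⊆ V :=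
  sInter_subset_of_mem ⟨h, hV⟩

lemma isTight_unreachableHull (hE : M.E = N.E) (hI : M.IsBase I) :
    IsTight M N I (unreachableHull M N I) where
  subset_closure := by
    have : Nonempty {V // IsTight M N I V ∧ unreachable M N I ⊆ V} :=
      ⟨M.E, isTight_ground hE hI, fun _ he ↦ he.1⟩
    have hcl := hI.indep.closure_iInter_eq_biInter_closure_of_forall_subset
      (Js := fun V : {V // IsTight M N I V ∧ unreachable M N I ⊆ V} ↦ I ∩ V.1)
      fun _ ↦ inter_subset_left
    rw [← inter_iInter] at hcl
    rw [unreachableHull, sInter_eq_iInter]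
    exact hcl ▸ subset_iInter fun V ↦ (iInter_subset _ V).trans V.2.1.subset_closure
  closure_sdiff_subset := by
    rintro a ⟨haI, ha⟩
    obtain ⟨V, hV, haV⟩ : ∃ V, (IsTight M N I V ∧ unreachable M N I ⊆ V) ∧ a ∉ V := by
      simpa [unreachableHull, and_assoc] using ha
    exact N.closure_subset_closure (sdiff_subset_sdiff_right (sInter_subset_of_mem hV))
      (hV.1.closure_sdiff_subset ⟨haI, haV⟩)

lemma unreachableHull_subset_sdiff_swapReach (hE : M.E = N.E) (hI : M.Indep I) (hxI : x ∈ I)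
    (hx : x ∈ N.closure (I \ {x})) :
    unreachableHull M N I ⊆ M.E \ swapReach M N (I \ {x}) := by
  refine (isTight_ground_sdiff_swapReach hE hI hx).unreachableHull_subset ?_
  rintro z ⟨hzE, hz⟩
  refine ⟨hzE, fun ⟨_, J, hJ, hzJ⟩ ↦ ?_⟩
  have hstep : AugStep M N I (insert z J) := ⟨x, hxI, hx, J, z, hJ, hzE, hzJ, hz I .refl, rfl⟩
  exact hz _ (.single hstep) (N.mem_closure_of_mem' (.inl rfl) (hE ▸ hzE))

lemma mem_swapReach_sdiff_singleton (hI : M.Indep I) (hxI : x ∈ I) :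
    x ∈ swapReach M N (I \ {x}) :=
  ⟨hI.subset_ground hxI, _, .refl, hI.notMem_closure_sdiff_of_mem hxI⟩

lemma notMem_closure_sdiff_of_mem_unreachableHull (hE : M.E = N.E) (hI : M.Indep I) (hxI : x ∈ I)
    (hxV : x ∈ unreachableHull M N I) : x ∉ N.closure (I \ {x}) := fun hx ↦
  (unreachableHull_subset_sdiff_swapReach hE hI hxI hx hxV).2
    (mem_swapReach_sdiff_singleton hI hxI)

lemma AugStep.inter_unreachableHull (h : AugStep M N I I') (hE : M.E = N.E) (hI : M.Indep I) :
    I' ∩ unreachableHull M N I = I ∩ unreachableHull M N I := by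
  obtain ⟨x, hxI, hx, J, r, hs, hrE, hrJ, -, rfl⟩ := h
  have hV := unreachableHull_subset_sdiff_swapReach hE hI hxI hx
  have hJ := hs.sdiff_swapReach (hI.subset sdiff_subset)
  have hxR : x ∈ swapReach M N (I \ {x}) := mem_swapReach_sdiff_singleton hI hxI
  have hrR : r ∈ swapReach M N (I \ {x}) := ⟨hrE, J, hs, hrJ⟩
  ext a
  have ha := Set.ext_iff.1 hJ a
  grind

lemma AugStep.isTight_inter (h : AugStep M N I I') (hE : M.E = N.E) (hI : M.IsBase I)
    (hV : IsTight M N I V) (hIV : I' ∩ V = I ∩ V) (hW : IsTight M N I' W) :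
    IsTight M N I (W ∩ V) where
  subset_closure := by
    rintro v ⟨hvW, hvV⟩
    have hI' : M.Indep ((I' ∩ W) ∪ (I' ∩ V)) :=
      (h.isBase hI).indep.subset (union_subset inter_subset_left inter_subset_left)
    have hv : v ∈ M.closure (I' ∩ W ∩ (I' ∩ V)) := by
      rw [hI'.closure_inter_eq_inter_closure]
      exact ⟨hW.subset_closure hvW, hIV ▸ hV.subset_closure hvV⟩
    exact M.closure_subset_closure (by grind) hv
  closure_sdiff_subset := by
    rintro d ⟨hdI, hdVW⟩
    by_cases hdV : d ∉ V
    · exact N.closure_subset_closure (sdiff_subset_sdiff_right inter_subset_right)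
        (hV.closure_sdiff_subset ⟨hdI, hdV⟩)
    have hdW : d ∈ N.closure (I' \ W) :=
      hW.closure_sdiff_subset ⟨h.closure_subset hdI, fun hd ↦ hdVW ⟨hd, not_not.1 hdV⟩⟩
    obtain ⟨x, -, hx, J, r, hs, hrE, -, hrN, rfl⟩ := h
    have hJE : J ⊆ N.E := hE ▸ (hs.indep (hI.indep.subset sdiff_subset)).subset_ground
    have hJI : J ⊆ N.closure I := by
      rw [← closure_sdiff_singleton_eq_closure hx, ← hs.closure_eq]
      exact N.subset_closure J hJE
    have hd : d ∈ N.closure (insert r (I \ (W ∩ V))) := by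
      refine closure_subset_closure_of_subset_closure ?_ hdW
      rintro a ⟨rfl | ha, haW⟩
      · exact N.mem_closure_of_mem' (.inl rfl) (hE ▸ hrE)
      by_cases haV : a ∈ V
      · have haI : a ∈ I ∩ V := hIV ▸ ⟨.inr ha, haV⟩
        exact N.mem_closure_of_mem' (by grind) (hJE ha)
      · exact N.closure_subset_closure (by grind) (hV.closure_sdiff_subset ⟨hJI ha, haV⟩)
    -- otherwise `d` could be exchanged for `r`, which would put `r` into the span of `I`
    by_contra hcon
    refine hrN (closure_subset_closure_of_subset_closure ?_ (mem_closure_insert hcon hd))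
    exact insert_subset hdI (sdiff_subset.trans (N.subset_closure I (hE ▸ hI.subset_ground)))

lemma AugStep.unreachableHull_subset (h : AugStep M N I I') (hE : M.E = N.E) (hI : M.IsBase I) :
    unreachableHull M N I ⊆ unreachableHull M N I' := by
  refine subset_sInter fun W ⟨hW, hIW⟩ ↦ ?_
  have htight := h.isTight_inter hE hI (isTight_unreachableHull hE hI)
    (h.inter_unreachableHull hE hI.indep) hW
  exact (htight.unreachableHull_subset (subset_inter ((Augs.unreachable_subset (.single h)).trans
    hIW) unreachable_subset_unreachableHull)).trans inter_subset_left

lemma Augs.unreachableHull_subset (h : Augs M N I I') (hE : M.E = N.E) (hI : M.IsBase I) :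
    unreachableHull M N I ⊆ unreachableHull M N I' := by
  induction h with
  | refl => rfl
  | tail h hstep ih => exact ih.trans (hstep.unreachableHull_subset hE (Augs.isBase h hI))

lemma Augs.inter_unreachableHull (h : Augs M N I I') (hE : M.E = N.E) (hI : M.IsBase I) :
    I' ∩ unreachableHull M N I = I ∩ unreachableHull M N I := by
  induction h with
  | refl => rfl
  | tail h hstep ih =>
    have hsub := Augs.unreachableHull_subset h hE hI
    have heq := hstep.inter_unreachableHull hE (Augs.isBase h hI).indep
    rw [← ih, ← inter_eq_self_of_subset_right hsub, ← inter_assoc, heq, inter_assoc]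

lemma exists_augs_mem_closure_or_mem_unreachable {e : β} (he : e ∈ M.E) (I : Set β) :
    ∃ I', Augs M N I I' ∧ (e ∈ N.closure I' ∨ e ∈ unreachable M N I') := by
  by_cases h : e ∈ unreachable M N I
  · exact ⟨I, .refl, .inr h⟩
  · obtain ⟨I', hI', heI'⟩ : ∃ I', Augs M N I I' ∧ e ∈ N.closure I' := by
      simpa [unreachable, he] using h
    exact ⟨I', hI', .inl heI'⟩

lemma monotone_inter_unreachableHull (hE : M.E = N.E) {s : ℕ → Set β}
    (hs : ∀ m n, m ≤ n → Augs M N (s m) (s n)) (hbase : ∀ n, M.IsBase (s n)) :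
    Monotone fun n ↦ s n ∩ unreachableHull M N (s n) := fun m n hmn ↦
  subset_inter (((hs m n hmn).inter_unreachableHull hE (hbase m)).superset.trans inter_subset_left)
    (inter_subset_right.trans ((hs m n hmn).unreachableHull_subset hE (hbase m)))

lemma eventually_mem_closure_sdiff_singleton (hE : M.E = N.E) {s : ℕ → Set β} {a t : β}
    (hs : ∀ m n, m ≤ n → Augs M N (s m) (s n)) (hbase : ∀ n, M.IsBase (s n))
    (hspan : ∀ e ∈ M.E, ∃ n, e ∈ N.closure (s n) ∨ e ∈ unreachable M N (s n))
    (ht : t ∈ ⋃ n, s n ∩ unreachableHull M N (s n))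
    (ha : a ∈ (⋃ n, s n ∩ unreachableHull M N (s n)) \ {t} ∪
      (N.E \ ⋃ n, unreachableHull M N (s n))) :
    ∀ᶠ m in Filter.atTop, a ∈ N.closure (s m \ {t}) := by
  have hmono := monotone_inter_unreachableHull hE hs hbase
  obtain ⟨k, htk⟩ := mem_iUnion.1 ht
  obtain ⟨ha', hat⟩ | ⟨haE, haV⟩ := ha
  · obtain ⟨n, hn⟩ := mem_iUnion.1 ha'
    filter_upwards [Filter.eventually_ge_atTop n] with m hm
    exact N.mem_closure_of_mem' ⟨(hmono hm hn).1, hat⟩ (hE ▸ (hbase n).subset_ground hn.1)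
  · have haV n : a ∉ unreachableHull M N (s n) := fun h ↦ haV (mem_iUnion_of_mem n h)
    obtain ⟨n, hn⟩ := hspan a (hE ▸ haE)
    have hn := hn.resolve_right fun h ↦ haV n (unreachable_subset_unreachableHull h)
    filter_upwards [Filter.eventually_ge_atTop n, Filter.eventually_ge_atTop k] with m hm hkm
    refine N.closure_subset_closure (sdiff_subset_sdiff_right (singleton_subset_iff.2 ?_))
      ((isTight_unreachableHull hE (hbase m)).closure_sdiff_subset
        ⟨(hs n m hm).closure_subset hn, haV m⟩)
    exact (hmono hkm htk).2

lemma isWave_iUnion_unreachableHull [M.Finitary] [N.Finitary] (hE : M.E = N.E) {s : ℕ → Set β}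
    (hs : ∀ m n, m ≤ n → Augs M N (s m) (s n)) (hbase : ∀ n, M.IsBase (s n))
    (hspan : ∀ e ∈ M.E, ∃ n, e ∈ N.closure (s n) ∨ e ∈ unreachable M N (s n)) :
    IsWave M N (⋃ n, unreachableHull M N (s n)) (⋃ n, s n ∩ unreachableHull M N (s n)) where
  isBasis := by
    have hindep := indep_iUnion_of_directed
      (monotone_inter_unreachableHull hE hs hbase).directed_le
      fun n ↦ (hbase n).indep.subset inter_subset_left
    refine hindep.isBasis_of_subset_of_subset_closure (iUnion_mono fun n ↦ inter_subset_right)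
      (iUnion_subset fun n ↦ (isTight_unreachableHull hE (hbase n)).subset_closure.trans ?_)
    exact M.closure_subset_closure (subset_iUnion (fun n ↦ s n ∩ unreachableHull M N (s n)) n)
  indep := by
    have hsub : ⋃ n, s n ∩ unreachableHull M N (s n) ⊆ N.E := hE ▸
      iUnion_subset fun n ↦ inter_subset_left.trans (hbase n).subset_ground
    refine contract_indep_iff_forall_notMem_closure.2 ⟨subset_sdiff.2 ⟨hsub, disjoint_left.2
      fun a ha haV ↦ haV.2 (iUnion_mono (fun n ↦ inter_subset_right) ha)⟩, fun t ht hcon ↦ ?_⟩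
    -- a finite set spanning `t` would make `t` redundant in some late `s m`
    obtain ⟨F, hFsub, hFfin, -, hF⟩ := exists_mem_finite_closure_of_mem_closure hcon
    have hev : ∀ᶠ m in Filter.atTop, ∀ a ∈ F, a ∈ N.closure (s m \ {t}) :=
      (Filter.eventually_all_finite hFfin).2 fun a ha ↦
        eventually_mem_closure_sdiff_singleton hE hs hbase hspan ht (hFsub ha)
    obtain ⟨k, htk⟩ := mem_iUnion.1 ht
    obtain ⟨m, hm, hkm⟩ := (hev.and (Filter.eventually_ge_atTop k)).exists
    obtain ⟨hts, htV⟩ := monotone_inter_unreachableHull hE hs hbase hkm htk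
    exact notMem_closure_sdiff_of_mem_unreachableHull hE (hbase m).indep hts htV
      (closure_subset_closure_of_subset_closure hm hF)

theorem Loose.exists_augs [M.Finitary] [N.Finitary] (hL : Loose M N) (hE : M.E = N.E)
    (hc : M.E.Countable) (hI : M.IsBase I) (hT : T.Finite) (hTE : T ⊆ M.E) :
    ∃ I', Augs M N I I' ∧ T ⊆ N.closure I' := by
  have : Std.Refl (Augs M N) := ⟨fun _ ↦ .refl⟩
  have : IsTrans (Set β) (Augs M N) := ⟨fun _ _ _ ↦ .trans⟩
  obtain ⟨s, rfl, hs, hspan⟩ := exists_seq_of_countable hc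
    (fun _ he ↦ exists_augs_mem_closure_or_mem_unreachable (N := N) he) I
  have hempty := hL _ _ (isWave_iUnion_unreachableHull hE hs
    (fun n ↦ (hs 0 n n.zero_le).isBase hI) hspan)
  have hunr e n : e ∉ unreachable M N (s n) := fun he ↦
    (hempty ▸ mem_iUnion_of_mem n (unreachable_subset_unreachableHull he) : e ∈ (∅ : Set β))
  have hmono : Monotone fun n ↦ N.closure (s n) := fun m n hmn ↦ (hs m n hmn).closure_subset
  have hcover : T ⊆ ⋃ n, N.closure (s n) := fun a ha ↦
    let ⟨n, hn⟩ := hspan a (hTE ha)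
    mem_iUnion_of_mem n (hn.resolve_right (hunr a n))
  obtain ⟨n, hn⟩ := exists_subset_of_finite_of_subset_iUnion hmono.directed_le hT hcover
  exact ⟨s n, hs 0 n n.zero_le, hn⟩

end Augmentation

section Intersection

variable {β : Type*} {M N : Matroid β} {B I I' J Q T W S : Set β}

lemma contract_indep_of_subset_closure (hJ : (N ／ (I' ∪ T)).Indep J) (hIJ : Disjoint I J)
    (hI : I ⊆ N.closure I') : (N ／ (I ∪ T)).Indep J := by
  rw [contract_indep_iff_forall_notMem_closure] at hJ ⊢
  refine ⟨subset_sdiff.2 ⟨hJ.1.trans sdiff_subset, disjoint_left.2 ?_⟩, fun e he hcl ↦ ?_⟩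
  · exact fun a haJ ha ↦ ha.elim (disjoint_right.1 hIJ haJ) fun haT ↦ (hJ.1 haJ).2 (.inr haT)
  · refine hJ.2 e he ?_
    rw [← closure_inter_ground] at hcl
    refine closure_subset_closure_of_subset_closure ?_ hcl
    rintro a ⟨haJ | haI | haT, haE⟩
    · exact N.mem_closure_of_mem' (.inl haJ)
    · exact N.closure_subset_closure (subset_union_left.trans subset_union_right) (hI haI)
    · exact N.mem_closure_of_mem' (.inr (.inr haT))

lemma Loose.of_subset_closure (hL : Loose (M ／ Q) (N ／ I ＼ Q)) (hI : I ⊆ Q) (hI' : I' ⊆ Q)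
    (hII' : I ⊆ N.closure I') : Loose (M ／ Q) (N ／ I' ＼ Q) := by
  intro W S hW
  obtain ⟨hS, hSQ⟩ := (contractOnto_contract_delete_indep_iff hI').1 hW.indep
  exact hL W S ⟨hW.isBasis, (contractOnto_contract_delete_indep_iff hI).2
    ⟨contract_indep_of_subset_closure hS (hSQ.symm.mono_left hI) hII', hSQ⟩⟩

lemma isBasis_inter_of_isBase_of_sdiff_subset (hQ : M.IsBasis (I ∩ Q) Q) (hI : M.Indep I)
    (hB : M.IsBase B) (hBI : B \ I ⊆ Q) : M.IsBasis (B ∩ Q) Q := by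
  obtain ⟨J, hJ, hBJ⟩ := (hB.indep.inter_right Q).subset_isBasis_of_subset inter_subset_right
    hQ.subset_ground
  have hrest : (M ／ Q).Indep (I \ Q) :=
    hQ.contract_indep_iff.2 ⟨by rwa [sdiff_union_inter], disjoint_sdiff_right⟩
  have hJI : M.Indep (I \ Q ∪ J) := (hJ.contract_indep_iff.1 hrest).1
  have hBeq : B = I \ Q ∪ J := hB.eq_of_subset_indep hJI (by grind)
  have hJQ := hJ.subset
  rwa [show B ∩ Q = J by grind]

lemma exists_isFeasible_chain {P : β → Set β → Set β → Prop} (hL : Loose M N)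
    (hc : M.E.Countable)
    (hstep : ∀ e ∈ M.E, ∀ Q I, IsFeasible M N Q I →
      ∃ Q' I', IsFeasible M N Q' I' ∧ Q ⊆ Q' ∧ I ⊆ I' ∧ P e Q' I') :
    ∃ Q I : ℕ → Set β, Monotone Q ∧ Monotone I ∧ (∀ n, IsFeasible M N (Q n) (I n)) ∧
      ∀ e ∈ M.E, ∃ n, P e (Q n) (I n) := by
  let r (p q : {p : Set β × Set β // IsFeasible M N p.1 p.2}) : Prop := p.1 ≤ q.1
  have : Std.Refl r := ⟨fun _ ↦ le_rfl⟩
  have : IsTrans _ r := ⟨fun _ _ _ ↦ le_trans⟩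
  obtain ⟨s, -, hs, hP⟩ := exists_seq_of_countable (r := r) (P := fun e p ↦ P e p.1.1 p.1.2) hc
    (fun e he p ↦ by
      obtain ⟨Q', I', h, hQ, hI, hP⟩ := hstep e he p.1.1 p.1.2 p.2
      exact ⟨⟨(Q', I'), h⟩, ⟨hQ, hI⟩, hP⟩) ⟨(∅, ∅), hL.isFeasible_empty⟩
  exact ⟨fun n ↦ (s n).1.1, fun n ↦ (s n).1.2, fun m n h ↦ (hs m n h).1, fun m n h ↦ (hs m n h).2,
    fun n ↦ (s n).2, hP⟩

lemma Loose.exists_isFeasible_exhaustion [M.Finitary] (hL : Loose M N) (hE : M.E = N.E)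
    (hc : M.E.Countable) :
    ∃ Q I : ℕ → Set β, Monotone Q ∧ (⋃ n, Q n) = M.E ∧ M.IsBase (⋃ n, I n) ∧
      ∀ n, IsFeasible M N (Q n) (I n) := by
  obtain ⟨Q, I, hQ, hI, hf, hmem⟩ := exists_isFeasible_chain hL hc (P := fun e Q _ ↦ e ∈ Q)
    fun e he Q I h ↦ by
      by_cases heQ : e ∈ Q
      · exact ⟨Q, I, h, Subset.rfl, Subset.rfl, heQ⟩
      obtain ⟨Q', I', h', he'⟩ := h.loose.exists_isFeasible_mem (u := e)
        (by rw [contract_ground, contract_delete_ground_of_subset h.isBasis.subset, hE])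
        ⟨he, heQ⟩
      exact ⟨_, _, h.union hE h', subset_union_left, subset_union_left, .inr he'⟩
  refine ⟨Q, I, hQ, (iUnion_subset fun n ↦ (hf n).isBasis.subset_ground).antisymm fun e he ↦
    mem_iUnion.2 (hmem e he), ?_, hf⟩
  have hi := indep_iUnion_of_directed hI.directed_le fun n ↦ (hf n).isBasis.indep
  refine hi.isBase_of_ground_subset_closure fun e he ↦ ?_
  obtain ⟨n, hn⟩ := hmem e he
  exact M.closure_subset_closure (subset_iUnion I n) ((hf n).isBasis.subset_closure hn)

lemma IsFeasible.of_subset_closure (h : IsFeasible M N Q I) (hI' : M.IsBasis I' Q)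
    (hE : M.E = N.E) (hII' : I ⊆ N.closure I') : IsFeasible M N Q I' := by
  refine ⟨hI', ?_, h.loose.of_subset_closure h.isBasis.subset hI'.subset hII'⟩
  have hsub : I' ∪ (N.E \ Q) ⊆ N.E :=
    union_subset (hE ▸ hI'.indep.subset_ground) sdiff_subset
  refine (spanning_iff_ground_subset_closure hsub).2 (h.spanning.closure_eq.superset.trans ?_)
  exact closure_subset_closure_of_subset_closure (union_subset
    (hII'.trans (N.closure_subset_closure subset_union_left))
    (N.subset_closure_of_subset' subset_union_right sdiff_subset))

lemma Loose.exists_isFeasible_subset_closure [M.Finitary] [N.Finitary] (hL : Loose M N)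
    (hE : M.E = N.E) (hc : M.E.Countable) (hT : T.Finite) (hTE : T ⊆ M.E) :
    ∃ Q I, IsFeasible M N Q I ∧ T ⊆ N.closure I := by
  obtain ⟨Q, I, hQ, hQE, hI, hf⟩ := hL.exists_isFeasible_exhaustion hE hc
  obtain ⟨B, hIB, hTB⟩ := hL.exists_augs hE hc hI hT hTE
  have hB := hIB.isBase hI
  have hIE : ⋃ n, I n ⊆ N.closure (⋃ n, I n) := N.subset_closure _ (hE ▸ hI.subset_ground)
  obtain ⟨G, hGB, hGfin, -, hG⟩ := exists_subset_finite_closure_of_subset_closure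
    (hIB.finite_sdiff.2.union hT)
    (union_subset (sdiff_subset.trans (hIE.trans hIB.closure_subset)) hTB)
  obtain ⟨n, hn⟩ := exists_subset_of_finite_of_subset_iUnion hQ.directed_le
    (hIB.finite_sdiff.1.union hGfin)
    (hQE ▸ (union_subset sdiff_subset hGB).trans hB.subset_ground)
  have hInQ : (⋃ n, I n) ∩ Q n = I n :=
    ((hf n).isBasis.eq_of_subset_indep (hI.indep.inter_right _)
      (subset_inter (subset_iUnion I n) (hf n).isBasis.subset) inter_subset_right).symm
  have hbasis : M.IsBasis (B ∩ Q n) (Q n) := isBasis_inter_of_isBase_of_sdiff_subset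
    (by simpa only [hInQ] using (hf n).isBasis) hI.indep hB (subset_union_left.trans hn)
  have hcl := hG.trans (N.closure_subset_closure (subset_inter hGB (subset_union_right.trans hn)))
  refine ⟨Q n, B ∩ Q n, (hf n).of_subset_closure hbasis hE fun a ha ↦ ?_,
    subset_union_right.trans hcl⟩
  by_cases haB : a ∈ B
  · exact N.mem_closure_of_mem' ⟨haB, (hf n).isBasis.subset ha⟩
      (hE ▸ (hf n).isBasis.indep.subset_ground ha)
  · exact hcl (.inl ⟨mem_iUnion.2 ⟨n, ha⟩, haB⟩)

lemma IsFeasible.exists_mem_closure [M.Finitary] [N.Finitary] {e : β} (h : IsFeasible M N Q I)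
    (hE : M.E = N.E) (hc : M.E.Countable) (he : e ∈ N.E) :
    ∃ Q' I', IsFeasible M N Q' I' ∧ Q ⊆ Q' ∧ I ⊆ I' ∧ e ∈ N.closure I' := by
  obtain ⟨F, hF, hFfin, -, heF⟩ :=
    exists_mem_finite_closure_of_mem_closure (h.spanning.closure_eq.superset he)
  obtain ⟨Q', I', h', hF'⟩ := h.loose.exists_isFeasible_subset_closure
    (by rw [contract_ground, contract_delete_ground_of_subset h.isBasis.subset, hE])
    (hc.mono sdiff_subset) (hFfin.subset inter_subset_left)
    (show F ∩ (N.E \ Q) ⊆ M.E \ Q from hE ▸ inter_subset_right)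
  refine ⟨_, _, h.union hE h', subset_union_left, subset_union_left,
    closure_subset_closure_of_subset_closure (fun a ha ↦ ?_) heF⟩
  obtain haI | haQ := hF ha
  · exact N.mem_closure_of_mem' (.inl haI) (hE ▸ h.isBasis.indep.subset_ground haI)
  · have hcl := hF' ⟨ha, haQ⟩
    rw [delete_closure_eq, contract_closure_eq] at hcl
    exact N.closure_subset_closure (by grind) hcl.1.1

theorem Loose.exists_indep_spanning [M.Finitary] [N.Finitary] (hL : Loose M N) (hE : M.E = N.E)
    (hc : M.E.Countable) : ∃ I, M.Indep I ∧ N.Spanning I := by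
  obtain ⟨Q, I, -, hI, hf, hmem⟩ := exists_isFeasible_chain hL hc
    (P := fun e _ I ↦ e ∈ N.closure I) fun e he Q I h ↦ h.exists_mem_closure hE hc (hE ▸ he)
  have hi := indep_iUnion_of_directed hI.directed_le fun n ↦ (hf n).isBasis.indep
  refine ⟨_, hi, (spanning_iff_ground_subset_closure (hE ▸ hi.subset_ground)).2 fun e he ↦ ?_⟩
  obtain ⟨n, hn⟩ := hmem e (hE ▸ he)
  exact N.closure_subset_closure (subset_iUnion I n) hn

/-- The conclusion of the matroid intersection conjecture: a common independent set `B` with a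
set `P` such that `B ∩ P` spans `P` in `M` and `B \ P` spans the complement of `P` in `N`. -/
structure IsIntersectionCertificate (M N : Matroid β) (B P : Set β) : Prop where
  left_indep : M.Indep B
  right_indep : N.Indep B
  left_isBasis : M.IsBasis (B ∩ P) P
  right_isBasis : N.IsBasis (B \ P) (N.E \ P)

lemma IsWave.isBasis_ground_sdiff (hW : IsWave M N W S) (hJ : N.Indep J) (hJW : J ⊆ N.E \ W)
    (hcl : N.E \ W ⊆ N.closure (S ∪ J)) : N.IsBasis J (N.E \ W) := by
  obtain ⟨K, hK, hJK⟩ := hJ.subset_isBasis_of_subset hJW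
  have hSK : N.Indep (S ∪ K) := (hK.contract_indep_iff.1 hW.indep).1
  suffices hKJ : K ⊆ J from hKJ.antisymm hJK ▸ hK
  intro e he
  by_contra heJ
  have heS : e ∉ S := fun h ↦ (hK.subset he).2 (hW.isBasis.subset h)
  exact hSK.notMem_closure_sdiff_of_mem (.inr he)
    (N.closure_subset_closure (by grind) (hcl (hK.subset he)))

theorem exists_isIntersectionCertificate_of_finitary [M.Finitary] [N.Finitary] (hE : M.E = N.E)
    (hc : M.E.Countable) : ∃ B P, IsIntersectionCertificate M N B P := by
  obtain ⟨W, S, hW, hL⟩ := exists_isWave_loose M N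
  have hSW := hW.isBasis.subset
  have hground := contract_delete_ground_of_subset (N := N) hSW
  obtain ⟨I, hI, hIN⟩ := hL.exists_indep_spanning
    (by rw [contract_ground, hground, hE]) (hc.mono sdiff_subset)
  have hIE : I ⊆ N.E \ W := hE ▸ hI.subset_ground
  have hISM : M.Indep (I ∪ S) := (hW.isBasis.contract_indep_iff.1 hI).1
  obtain ⟨J, hJ⟩ := N.exists_isBasis I (hIE.trans sdiff_subset)
  have hJE : J ⊆ N.E \ W := hJ.subset.trans hIE
  have hcl : N.E \ W ⊆ N.closure (S ∪ J) := by
    intro e he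
    have heI : e ∈ (N ／ S ＼ W).closure I := hIN.closure_eq.superset (by rwa [hground])
    rw [delete_closure_eq, contract_closure_eq] at heI
    rw [closure_union_congr_right hJ.closure_eq_closure, union_comm]
    exact N.closure_subset_closure (by grind) heI.1.1
  have hJbasis := hW.isBasis_ground_sdiff hJ.indep hJE hcl
  have hJW : Disjoint J W := (subset_sdiff.1 hJE).2
  refine ⟨S ∪ J, W, hISM.subset (by grind [hJ.subset]),
    (hJbasis.contract_indep_iff.1 hW.indep).1, ?_, ?_⟩
  · rw [show (S ∪ J) ∩ W = S by grind]
    exact hW.isBasis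
  · rw [show (S ∪ J) \ W = J by grind]
    exact hJbasis

end Intersection

section FinitarySumCofinitary

variable {β : Type*} {M N F C : Matroid β} {A A' Q Q' : Set β}

lemma mem_closure_of_notMem_dual_closure {X : Set β} {e : β} (he : e ∈ M.E) (heX : e ∉ X)
    (h : e ∉ M✶.closure ((M.E \ X) \ {e})) : e ∈ M.closure X := by
  have hcoloop : (M✶ ＼ X).IsColoop e := by
    rw [isColoop_iff_notMem_closure_compl (show e ∈ (M✶ ＼ X).E from ⟨he, heX⟩),
      delete_closure_eq_of_disjoint]
    · exact fun hcl ↦ h hcl.1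
    · exact disjoint_sdiff_left.mono_left sdiff_subset
  rw [← dual_contract, dual_isColoop_iff_isLoop, contract_isLoop_iff_mem_closure] at hcoloop
  exact hcoloop.1

/- `A'` is a basis of `M✶` outside `A ∩ Q`, and the elements of `Q \ A` are coloops there; dually
they are spanned by `A ∩ Q` in `M`. -/
lemma subset_closure_inter_of_dual (hQ : Q ⊆ A ∪ A' ∩ Q') (hQ' : Q' ⊆ A' ∪ A ∩ Q)
    (hA' : M✶.Indep A') (hcl : M.E \ Q' ⊆ M✶.closure (A' \ Q')) (hQE : Q ⊆ M.E) :
    Q ⊆ M.closure (A ∩ Q) := by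
  intro e he
  by_cases heA : e ∈ A
  · exact M.mem_closure_of_mem' ⟨heA, he⟩ (hQE he)
  refine mem_closure_of_notMem_dual_closure (hQE he) (fun h ↦ heA h.1) fun h ↦ ?_
  refine hA'.notMem_closure_sdiff_of_mem (e := e) (by grind)
    (closure_subset_closure_of_subset_closure (fun a ha ↦ ?_) h)
  by_cases haQ' : a ∈ Q'
  · exact M✶.mem_closure_of_mem' (by grind) ha.1.1
  · exact M✶.closure_subset_closure (by grind) (hcl ⟨ha.1.1, haQ'⟩)

lemma contract_indep_sdiff_of_dual (hQ : Q ⊆ A ∪ A' ∩ Q') (hQ' : Q' ⊆ A' ∪ A ∩ Q)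
    (hAA' : Disjoint A A') (hA' : A' ⊆ M.E) (hcl : M.E \ Q' ⊆ M✶.closure (A' \ Q'))
    (hAE : A ⊆ M.E) : (M ／ Q).Indep (A \ Q) := by
  have hspan : (M ／ Q)✶.Spanning (A' \ Q) := by
    rw [dual_contract, spanning_iff_ground_subset_closure (sdiff_subset_sdiff_left hA'),
      delete_closure_eq_of_disjoint _ disjoint_sdiff_left]
    have hsub : A' \ Q' ⊆ A' \ Q := by grind
    refine fun e (he : e ∈ M.E \ Q) ↦ ⟨?_, he.2⟩
    by_cases heA' : e ∈ A'
    · exact M✶.mem_closure_of_mem' ⟨heA', he.2⟩ he.1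
    · exact M✶.closure_subset_closure hsub (hcl ⟨he.1, by grind⟩)
  refine (dual_coindep_iff.1 hspan.compl_coindep).subset fun e he ↦ ⟨⟨hAE he.1, he.2⟩, ?_⟩
  exact fun h ↦ disjoint_left.1 hAA' he.1 h.1

lemma exists_subset_isBasis_of_dual (hQ : Q ⊆ A ∪ A' ∩ Q') (hQ' : Q' ⊆ A' ∪ A ∩ Q)
    (hAA' : Disjoint A A') (hA' : M✶.Indep A') (hcl : M.E \ Q' ⊆ M✶.closure (A' \ Q'))
    (hAE : A ⊆ M.E) (hQE : Q ⊆ M.E) :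
    ∃ K ⊆ A, M.Indep K ∧ M.IsBasis (K ∩ Q) Q ∧ A \ Q ⊆ K := by
  obtain ⟨K, hK⟩ := M.exists_isBasis (A ∩ Q) (inter_subset_right.trans hQE)
  have hKQ : M.IsBasis K Q := hK.indep.isBasis_of_subset_of_subset_closure
    (hK.subset.trans inter_subset_right)
    (hK.closure_eq_closure ▸ subset_closure_inter_of_dual hQ hQ' hA' hcl hQE)
  have hindep := (hKQ.contract_indep_iff.1
    (contract_indep_sdiff_of_dual hQ hQ' hAA' hA'.subset_ground hcl hAE)).1
  have hKA := hK.subset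
  refine ⟨A \ Q ∪ K, by grind, hindep, ?_, subset_union_left⟩
  rwa [show (A \ Q ∪ K) ∩ Q = K by grind]

lemma finitary_disjointSum [M.Finitary] [N.Finitary] (h : Disjoint M.E N.E) :
    (M.disjointSum N h).Finitary := by
  refine ⟨fun I hI ↦ disjointSum_indep_iff.2 ⟨?_, ?_, fun e he ↦ ?_⟩⟩
  · refine indep_of_forall_finite_subset_indep _ fun J hJ hJfin ↦ ?_
    have hJI := (disjointSum_indep_iff.1 (hI J (hJ.trans inter_subset_left) hJfin)).1
    rwa [inter_eq_self_of_subset_left (hJ.trans inter_subset_right)] at hJI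
  · refine indep_of_forall_finite_subset_indep _ fun J hJ hJfin ↦ ?_
    have hJI := (disjointSum_indep_iff.1 (hI J (hJ.trans inter_subset_left) hJfin)).2.1
    rwa [inter_eq_self_of_subset_left (hJ.trans inter_subset_right)] at hJI
  · exact (disjointSum_indep_iff.1 (hI {e} (by simpa) (finite_singleton e))).2.2 rfl

lemma finitary_sum {α : Type*} {L : Matroid α} [L.Finitary] [N.Finitary] :
    (L.sum N).Finitary := by
  refine ⟨fun I hI ↦ (sum_indep_iff _ _).2 ⟨?_, ?_⟩⟩
  · refine indep_of_forall_finite_subset_indep _ fun J hJ hJfin ↦ ?_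
    have hJI := hI (Sum.inl '' J) (image_subset_iff.2 hJ) (hJfin.image _)
    simpa [preimage_image_eq _ Sum.inl_injective] using ((sum_indep_iff _ _).1 hJI).1
  · refine indep_of_forall_finite_subset_indep _ fun J hJ hJfin ↦ ?_
    have hJI := hI (Sum.inr '' J) (image_subset_iff.2 hJ) (hJfin.image _)
    simpa [preimage_image_eq _ Sum.inr_injective] using ((sum_indep_iff _ _).1 hJI).2

lemma image_sumElim_id (X : Set (β ⊕ β)) :
    Sum.elim id id '' X = Sum.inl ⁻¹' X ∪ Sum.inr ⁻¹' X := by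
  ext e
  simp

lemma exists_isIntersectionCertificate_disjointSum {B₁ B₂ P₁ P₂ : Set β} (hd : Disjoint F.E C.E)
    (hE : F.E ∪ C.E = N.E) (hB : Disjoint B₁ B₂) (hP₁ : P₁ ⊆ N.E) (hF : F.Indep (B₁ ∩ F.E))
    (hFP : F.IsBasis (B₁ ∩ P₁ ∩ F.E) (P₁ ∩ F.E)) (hC : C✶.Indep B₂)
    (hCP : (P₁ ∪ P₂) ∩ C.E ⊆ B₁ ∩ P₁ ∪ B₂ ∩ P₂) (hcl : C.E \ P₂ ⊆ C✶.closure (B₂ \ P₂))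
    (hN : N.Indep B₁) (hNP : N.IsBasis (B₁ \ P₁) (N.E \ P₁)) :
    ∃ B, IsIntersectionCertificate (F.disjointSum C hd) N B P₁ := by
  have hB₂C : B₂ ⊆ C.E := hC.subset_ground
  rw [union_inter_distrib_right, union_subset_iff] at hCP
  have hB₁E : B₁ ⊆ F.E ∪ C.E := hN.subset_ground.trans hE.superset
  obtain ⟨K, hKB, hK, hKP, hKA⟩ := exists_subset_isBasis_of_dual (M := C)
    (A := B₁ ∩ C.E) (A' := B₂) (Q := P₁ ∩ C.E) (Q' := P₂ ∩ C.E) (by grind) (by grind)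
    (hB.mono_left inter_subset_left) hC
    (fun e he ↦ C✶.closure_subset_closure (by grind) (hcl (show e ∈ C.E \ P₂ by grind)))
    inter_subset_right inter_subset_right
  have hKF : (B₁ ∩ F.E ∪ K) ∩ F.E = B₁ ∩ F.E := by grind
  have hKC : (B₁ ∩ F.E ∪ K) ∩ C.E = K := by grind
  have hKsub : B₁ ∩ F.E ∪ K ⊆ B₁ := by grind
  refine ⟨B₁ ∩ F.E ∪ K, ?_, hN.subset hKsub, ?_, ?_⟩
  · exact disjointSum_indep_iff.2 ⟨by rwa [hKF], by rwa [hKC], hKsub.trans hB₁E⟩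
  · refine disjointSum_isBasis_iff.2 ⟨?_, ?_, inter_subset_right, hP₁.trans hE.superset⟩
    · rwa [inter_right_comm, hKF, inter_right_comm]
    · rwa [inter_right_comm, hKC, show K ∩ P₁ = K ∩ (P₁ ∩ C.E) by grind]
  · have hsdiff : B₁ \ P₁ ⊆ B₁ ∩ F.E ∪ K := by grind
    rwa [(sdiff_subset_sdiff_left hKsub).antisymm fun e he ↦ ⟨hsdiff he, he.2⟩]

lemma IsIntersectionCertificate.of_sum_dual {B P : Set (β ⊕ β)} (hd : Disjoint F.E C.E)
    (hE : F.E ∪ C.E = N.E)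
    (h : IsIntersectionCertificate
      ((F.disjointSum (freeOn C.E) hd).comap (Sum.elim id id)) (N.sum (C✶ ↾ N.E)) B P) :
    ∃ B', IsIntersectionCertificate (F.disjointSum C hd) N B' (Sum.inl ⁻¹' P) := by
  obtain ⟨hMB, hinj⟩ := comap_indep_iff.1 h.left_indep
  have hMP := (comap_isBasis_iff.1 h.left_isBasis).1
  obtain ⟨hNB₁, hNB₂⟩ := (sum_indep_iff _ _).1 h.right_indep
  obtain ⟨hNP₁, hNP₂⟩ := sum_isBasis_iff.1 h.right_isBasis
  have hdisj : Disjoint (Sum.inl ⁻¹' B) (Sum.inr ⁻¹' B) := disjoint_left.2 fun e h₁ h₂ ↦ by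
    simpa using hinj h₁ h₂ rfl
  rw [image_sumElim_id] at hMB
  simp only [image_sumElim_id, preimage_inter, sum_ground, preimage_sdiff, preimage_union,
    preimage_image_eq _ Sum.inl_injective, preimage_image_eq _ Sum.inr_injective,
    preimage_inl_image_inr, preimage_inr_image_inl, union_empty, empty_union,
    restrict_ground_eq] at hMP hNP₁ hNP₂
  obtain ⟨hFP, hCP, -, hP⟩ := disjointSum_isBasis_iff.1 hMP
  have hC := (restrict_indep_iff.1 hNB₂).1
  have hB₂C : Sum.inr ⁻¹' B ⊆ C.E := hC.subset_ground
  refine exists_isIntersectionCertificate_disjointSum (P₂ := Sum.inr ⁻¹' P) hd hE hdisj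
    (hE ▸ subset_union_left.trans hP) ?_ ?_ hC ?_ ?_ hNB₁ hNP₁
  · exact (disjointSum_indep_iff.1 hMB).1.subset (inter_subset_inter_left _ subset_union_left)
  · rw [union_inter_distrib_right, inter_right_comm (Sum.inr ⁻¹' B),
      (hd.symm.mono_left hB₂C).inter_eq, empty_inter, union_empty] at hFP
    exact hFP.isBasis_subset (inter_subset_inter_left _ inter_subset_right)
      (inter_subset_inter_left _ subset_union_left)
  · rw [freeOn_isBasis_iff] at hCP
    exact hCP.1.superset.trans inter_subset_left
  · refine fun e he ↦ (isBasis_restrict_iff'.1 hNP₂).1.subset_closure ⟨⟨?_, he.2⟩, he.1⟩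
    exact hE.subset (.inr he.1)

theorem exists_isIntersectionCertificate [N.Finitary] (hM : M.IsFinitarySumCofinitary)
    (hE : M.E = N.E) (hc : M.E.Countable) : ∃ B P, IsIntersectionCertificate M N B P := by
  obtain ⟨F, C, hd, hF, hC : C✶.Finitary, rfl⟩ := hM
  rw [disjointSum_ground_eq] at hE hc
  have := finitary_disjointSum (M := F) (N := freeOn C.E) hd
  have := finitary_sum (L := N) (N := C✶ ↾ N.E)
  have hground : ((F.disjointSum (freeOn C.E) hd).comap (Sum.elim id id)).E =
      (N.sum (C✶ ↾ N.E)).E := by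
    have hF := disjointSum_ground_eq (M := F) (N := freeOn C.E) (h := hd)
    ext (e | e) <;> simp [← hE, hF]
  obtain ⟨B, P, hBP⟩ := exists_isIntersectionCertificate_of_finitary hground (by
    rw [hground, sum_ground, restrict_ground_eq, ← hE]
    exact (hc.image _).union (hc.image _))
  obtain ⟨B', hB'⟩ := hBP.of_sum_dual hd hE
  exact ⟨B', _, hB'⟩

end FinitarySumCofinitary

section Family

variable {α Θ : Type*} {E : Set α}

lemma preimage_mk_sum'_ground (M : Θ → Matroid α) (i : Θ) :
    Prod.mk i ⁻¹' (Matroid.sum' M).E = (M i).E := by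
  ext e
  simp

lemma subset_sum'_ground_iff {M : Θ → Matroid α} {X : Set (Θ × α)} :
    X ⊆ (Matroid.sum' M).E ↔ ∀ i, Prod.mk i ⁻¹' X ⊆ (M i).E := by
  refine ⟨fun h i ↦ ?_, fun h ⟨i, e⟩ he ↦ ?_⟩
  · exact (preimage_mono h).trans (preimage_mk_sum'_ground M i).subset
  · exact (preimage_mk_sum'_ground M i).superset (h i he)

lemma dual_sum' (M : Θ → Matroid α) : (Matroid.sum' M)✶ = Matroid.sum' fun i ↦ (M i)✶ := by
  refine ext_isBase (by simp) fun B _ ↦ ?_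
  simp only [dual_isBase_iff', sum'_isBase_iff, preimage_sdiff, preimage_mk_sum'_ground,
    subset_sum'_ground_iff, forall_and]

lemma isFinitarySumCofinitary_sum' {M : Θ → Matroid α} (hM : ∀ i, (M i).IsFinitarySumCofinitary) :
    (Matroid.sum' M).IsFinitarySumCofinitary := by
  choose F C hd hF hC hM using hM
  have hdisj : Disjoint (Matroid.sum' F).E (Matroid.sum' C).E := disjoint_left.2 <| by
    rintro ⟨i, e⟩ heF heC
    exact (hd i).notMem_of_mem_left (by simpa using heF) (by simpa using heC)
  have hME : ∀ i, (M i).E = (F i).E ∪ (C i).E := fun i ↦ by rw [hM, disjointSum_ground_eq]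
  refine ⟨_, _, hdisj, Finitary.sum' hF, ?_, ext_isBase ?_ fun B hB ↦ ?_⟩
  · rw [IsCofinitary, dual_sum']
    exact Finitary.sum' hC
  · ext ⟨i, e⟩
    simp [hME]
  · have hBE : B ⊆ (Matroid.sum' F).E ∪ (Matroid.sum' C).E := fun ⟨i, e⟩ he ↦ by
      simpa [hME] using hB he
    have hBi := subset_sum'_ground_iff.1 hB
    simp only [hME] at hBi
    simp only [hM, sum'_isBase_iff, disjointSum_isBase_iff, preimage_inter,
      preimage_mk_sum'_ground, hBE, hBi, and_true, forall_and]

lemma isFinitarySumCofinitary_restrict {M : Matroid α} {X : Set α}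
    (hM : M.IsFinitarySumCofinitary) (hX : X ⊆ M.E) : (M ↾ X).IsFinitarySumCofinitary := by
  obtain ⟨F, C, hd, hF, hC : C✶.Finitary, rfl⟩ := hM
  refine ⟨F ↾ (X ∩ F.E), C ↾ (X ∩ C.E), hd.mono inter_subset_right inter_subset_right,
    inferInstance, ?_, ?_⟩
  · rw [IsCofinitary, ← delete_compl inter_subset_right, dual_delete]
    infer_instance
  · rw [disjointSum_ground_eq] at hX
    refine ext_indep ?_ fun I (hI : I ⊆ X) ↦ ?_
    · rw [restrict_ground_eq, disjointSum_ground_eq, restrict_ground_eq, restrict_ground_eq,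
        ← inter_union_distrib_left, inter_eq_self_of_subset_left hX]
    · simp only [restrict_indep_iff, disjointSum_indep_iff, restrict_ground_eq, ← inter_assoc,
        inter_eq_self_of_subset_left hI, hI, hI.trans hX, inter_subset_right,
        ← inter_union_distrib_left, subset_inter_iff, inter_subset_left.trans hI, and_true]

variable {M : Θ → Matroid α}

/-- The conclusion of the packing-covering theorem for a family of matroids on `E`: the part `Ep`
of `E` is packed and its complement is covered. -/
def HasPackingCovering (E : Set α) (M : Θ → Matroid α) : Prop :=
  ∃ Ep ⊆ E, (∃ S, IsPacking (fun i ↦ M i ↾ Ep) S) ∧ ∃ I, IsCovering (E \ Ep) (fun i ↦ M i ／ Ep) I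

lemma hasPackingCovering_of_isBasis {B : Θ → Set α} {Ep : Set α} (hME : ∀ i, (M i).E = E)
    (hEp : Ep ⊆ E) (hdisj : ∀ i j, i ≠ j → Disjoint (B i) (B j)) (hcover : E \ Ep ⊆ ⋃ i, B i)
    (hB : ∀ i, (M i).Indep (B i)) (hbasis : ∀ i, (M i).IsBasis (B i ∩ Ep) Ep) :
    HasPackingCovering E M := by
  refine ⟨Ep, hEp, ⟨fun i ↦ B i ∩ Ep, fun i j hij ↦ ?_, fun i ↦ ?_⟩, fun i ↦ B i \ Ep, ?_,
    fun i ↦ (hbasis i).contract_indep_iff.2 ⟨?_, disjoint_sdiff_right⟩⟩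
  · exact (hdisj i j hij).mono inter_subset_left inter_subset_left
  · exact (hbasis i).isBase_restrict.spanning
  · rw [← iUnion_sdiff]
    exact (sdiff_subset_sdiff_left (iUnion_subset fun i ↦ hME i ▸ (hB i).subset_ground)).antisymm
      fun e he ↦ ⟨hcover he, he.2⟩
  · rw [sdiff_union_inter]
    exact hB i

lemma hasPackingCovering_of_certificate {B P : Set (Θ × α)}
    (hME : ∀ i, (M i).E = E)
    (h : IsIntersectionCertificate (Matroid.sum' M) ((freeOn E).comap Prod.snd) B P) :
    HasPackingCovering E M := by
  obtain ⟨hBE, hinj⟩ := comap_indep_iff.1 h.right_indep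
  have hcover := ((freeOn_isBasis_iff ..).1 (comap_isBasis_iff.1 h.right_isBasis).1).1
  have hBi := sum'_indep_iff.1 h.left_indep
  have hBP := sum'_isBasis_iff.1 h.left_isBasis
  have exists_of_notMem : ∀ k, ∀ e ∈ E, (k, e) ∉ P → ∃ l, (l, e) ∈ B \ P := fun k e he hke ↦ by
    obtain ⟨⟨l, e⟩, hl, rfl⟩ := hcover.superset (mem_image_of_mem Prod.snd ⟨he, hke⟩)
    exact ⟨l, hl⟩
  let Ep := {e ∈ E | ∀ i, (i, e) ∈ P}
  have hBEp : ∀ i, Prod.mk i ⁻¹' (B ∩ P) ⊆ Ep := fun i e he ↦ by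
    have heE : e ∈ E := freeOn_indep_iff.1 hBE (mem_image_of_mem Prod.snd he.1)
    refine ⟨heE, by_contra fun hP ↦ ?_⟩
    obtain ⟨k, hk⟩ := not_forall.1 hP
    obtain ⟨l, hl⟩ := exists_of_notMem k e heE hk
    obtain rfl : i = l := congr_arg Prod.fst (hinj he.1 hl.1 rfl)
    exact hl.2 he.2
  refine hasPackingCovering_of_isBasis (Ep := Ep) hME (sep_subset _ _) (fun i j hij ↦ ?_)
    (fun e he ↦ ?_) hBi fun i ↦ ?_
  · exact disjoint_left.2 fun e hi hj ↦ hij (congr_arg Prod.fst (hinj hi hj rfl))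
  · obtain ⟨k, hk⟩ := not_forall.1 fun hP ↦ he.2 ⟨he.1, hP⟩
    obtain ⟨l, hl⟩ := exists_of_notMem k e he.1 hk
    exact mem_iUnion_of_mem l hl.1
  · have hEpP : Ep ⊆ Prod.mk i ⁻¹' P := fun e he ↦ he.2 i
    rw [show Prod.mk i ⁻¹' B ∩ Ep = Prod.mk i ⁻¹' (B ∩ P) from
      subset_antisymm (inter_subset_inter_right _ hEpP) (subset_inter (fun e he ↦ he.1) (hBEp i))]
    exact (hBP i).isBasis_subset (hBEp i) hEpP

theorem hasPackingCovering_of_countable [Countable Θ] (hE : E.Countable)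
    (hME : ∀ i, (M i).E = E) (hM : ∀ i, (M i).IsFinitarySumCofinitary) :
    HasPackingCovering E M := by
  have hground : (Matroid.sum' M).E = ((freeOn E).comap (Prod.snd : Θ × α → α)).E := by
    ext ⟨i, e⟩
    simp [hME]
  have hc : (Matroid.sum' M).E.Countable := by
    rw [sum'_ground_eq]
    exact countable_iUnion fun i ↦ (hME i ▸ hE).image _
  obtain ⟨B, P, h⟩ := exists_isIntersectionCertificate (isFinitarySumCofinitary_sum' hM) hground hc
  exact hasPackingCovering_of_certificate hME h

lemma exists_isPacking_of_spanning_empty {Θ₁ : Set Θ} (hM : ∀ i ∉ Θ₁, (M i).Spanning ∅)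
    (h : ∃ S, IsPacking (fun i : Θ₁ ↦ M i) S) : ∃ S, IsPacking M S := by
  classical
  obtain ⟨S, hdisj, hS⟩ := h
  refine ⟨fun i ↦ if hi : i ∈ Θ₁ then S ⟨i, hi⟩ else ∅, fun i j hij ↦ ?_, fun i ↦ ?_⟩
  · by_cases hi : i ∈ Θ₁ <;> by_cases hj : j ∈ Θ₁ <;> simp [hi, hj, hij, hdisj]
  · by_cases hi : i ∈ Θ₁
    · simpa [hi] using hS ⟨i, hi⟩
    · simpa [hi] using hM i hi

lemma exists_isCovering_union_of_isNonloop {Θ₁ : Set Θ} {X Z : Set α} {f : Z → Θ}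
    (hf : f.Injective) (hfΘ : ∀ z, f z ∉ Θ₁) (hfM : ∀ z, (M (f z)).IsNonloop z)
    (h : ∃ I, IsCovering X (fun i : Θ₁ ↦ M i) I) : ∃ I, IsCovering (X ∪ Z) M I := by
  classical
  obtain ⟨I, hIX, hI⟩ := h
  let J : Θ → Set α := fun i ↦ if hi : i ∈ Θ₁ then I ⟨i, hi⟩ else (↑) '' (f ⁻¹' {i})
  have hJ : ∀ i : Θ₁, J i = I i := fun i ↦ dif_pos i.2
  have hJf : ∀ i ∉ Θ₁, J i = (↑) '' (f ⁻¹' {i}) := fun i hi ↦ dif_neg hi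
  refine ⟨J, (iUnion_subset fun i ↦ ?_).antisymm (union_subset ?_ fun z hz ↦ ?_), fun i ↦ ?_⟩
  · by_cases hi : i ∈ Θ₁
    · exact (hJ ⟨i, hi⟩).subset.trans ((hIX ▸ subset_iUnion I _).trans subset_union_left)
    · rw [hJf i hi]
      exact (Subtype.coe_image_subset Z _).trans subset_union_right
  · rw [← hIX]
    exact iUnion_subset fun i ↦ (hJ i).superset.trans (subset_iUnion J i)
  · exact mem_iUnion_of_mem (f ⟨z, hz⟩) (hJf _ (hfΘ _) ▸ ⟨⟨z, hz⟩, rfl, rfl⟩)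
  · by_cases hi : i ∈ Θ₁
    · exact hJ ⟨i, hi⟩ ▸ hI ⟨i, hi⟩
    · have hsub : (f ⁻¹' {i}).Subsingleton := subsingleton_singleton.preimage hf
      rw [hJf i hi]
      obtain hempty | ⟨z, hz⟩ := hsub.eq_empty_or_singleton
      · simp [hempty]
      · obtain rfl : f z = i := hz.superset rfl
        rw [hz, image_singleton]
        exact (hfM z).indep

lemma hasPackingCovering_of_restrict {E' : Set α} {Θ₁ : Set Θ} (hME : ∀ i, (M i).E = E)
    (hE' : E' ⊆ E) (hloops : ∀ i ∉ Θ₁, E' ⊆ (M i).loops)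
    {f : (E \ E' : Set α) → Θ} (hf : f.Injective) (hfΘ : ∀ z, f z ∉ Θ₁)
    (hfM : ∀ z, (M (f z)).IsNonloop z)
    (h : HasPackingCovering E' fun i : Θ₁ ↦ M i ↾ E') : HasPackingCovering E M := by
  obtain ⟨Ep, hEp, ⟨S, hSdisj, hS⟩, I, hIE, hI⟩ := h
  have hEpi : ∀ i, Ep ⊆ (M i).E := fun i ↦ hME i ▸ hEp.trans hE'
  have hEploops : ∀ i ∉ Θ₁, Ep ⊆ (M i).loops := fun i hi ↦ hEp.trans (hloops i hi)
  refine ⟨Ep, hEp.trans hE', exists_isPacking_of_spanning_empty (fun i hi ↦ ?_) ⟨S, hSdisj, ?_⟩, ?_⟩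
  · exact (restrict_spanning_iff (empty_subset _) (hEpi i)).2 (hEploops i hi)
  · simpa only [restrict_restrict_eq _ hEp] using hS
  · rw [show E \ Ep = E' \ Ep ∪ E \ E' by grind]
    refine exists_isCovering_union_of_isNonloop hf hfΘ (fun z ↦ ?_) ⟨I, hIE, fun i ↦ ?_⟩
    · rw [contract_eq_delete_of_subset_loops (hEploops _ (hfΘ z)), delete_isNonloop_iff]
      exact ⟨hfM z, fun hz ↦ z.2.2 (hEp hz)⟩
    · have hIi := hI i
      simp only [restrict_contract_eq_contract_restrict _ hEp] at hIi
      exact (restrict_indep_iff.1 hIi).1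

theorem hasPackingCovering (hE : E.Countable) (hME : ∀ i, (M i).E = E)
    (hM : ∀ i, (M i).IsFinitarySumCofinitary) : HasPackingCovering E M := by
  let E' := {e ∈ E | {i | (M i).IsNonloop e}.Countable}
  let Θ₁ := ⋃ e ∈ E', {i | (M i).IsNonloop e}
  have hE' : E' ⊆ E := sep_subset _ _
  have hΘ₁ : Θ₁.Countable := (hE.mono hE').biUnion fun e he ↦ he.2
  have hloops : ∀ i ∉ Θ₁, E' ⊆ (M i).loops := fun i hi e he ↦ by_contra fun hel ↦
    hi (mem_biUnion he ((isNonloop_iff_notMem_loops (hME i ▸ hE' he)).2 hel))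
  have hinf : ∀ z : (E \ E' : Set α), ({i | (M i).IsNonloop z} \ Θ₁).Infinite := fun z hfin ↦
    z.2.2 ⟨z.2.1, (hfin.countable.union hΘ₁).mono (subset_sdiff_union _ _)⟩
  have : Countable (E \ E' : Set α) := (hE.mono sdiff_subset).to_subtype
  have : Countable Θ₁ := hΘ₁.to_subtype
  obtain ⟨f, hf, hfN⟩ := exists_injective_forall_mem hinf
  refine hasPackingCovering_of_restrict hME hE' hloops hf (fun z ↦ (hfN z).2) (fun z ↦ (hfN z).1) ?_
  exact hasPackingCovering_of_countable (hE.mono hE') (fun _ ↦ rfl) fun i ↦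
    isFinitarySumCofinitary_restrict (hM i) (hME i ▸ hE')

end Family

end PackingCovering

theorem theorem1p1 {α Θ : Type*} (E : Set α) (hE : E.Countable) (M : Θ → Matroid α)
    (hME : ∀ i, (M i).E = E) (hM : ∀ i, (M i).IsFinitarySumCofinitary) :
    ∃ Ep Ec : Set α, Ep ∪ Ec = E ∧ Disjoint Ep Ec ∧
      (∃ S : Θ → Set α, Matroid.IsPacking (fun i => (M i).restrict Ep) S) ∧
      (∃ I : Θ → Set α, Matroid.IsCovering Ec (fun i => (M i).contractOnto Ec) I) := by
  obtain ⟨Ep, hEp, hpacking, hcovering⟩ := PackingCovering.hasPackingCovering hE hME hM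
  have contractOnto_sdiff : ∀ i, (M i).contractOnto (E \ Ep) = (M i).contract Ep := fun i ↦ by
    rw [Matroid.contractOnto, hME, Set.sdiff_sdiff_cancel_left hEp]
  refine ⟨Ep, E \ Ep, Set.union_sdiff_cancel hEp, Set.disjoint_sdiff_right, hpacking, ?_⟩
  simpa only [contractOnto_sdiff] using hcovering
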